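/- Let $k\ge 1$, $n\ge 4k$, and let $(M,g)$ be a connected smooth Riemannian manifold of dimension $n$. Let $\mathcal D^{p,p}=\Lambda^pT^*M\otimes\Lambda^pT^*M$ be the bundle of double forms of degree $p$, with the exterior product $(\alpha\otimes\beta)(\gamma\otimes\delta)=(\alpha\wedge\gamma)\otimes(\beta\wedge\delta)$, so that $g\in\mathcal D^{1,1}$ and the covariant Riemann curvature tensor $R\in\mathcal D^{2,2}$; powers are taken with respect to this product. Let $c:\mathcal D^{p,p}\to\mathcal D^{p-1,p-1}$ be the Ricci contraction, $c\,\omega(x_2,\dots,x_p;y_2,\dots,y_p)=\sum_{j=1}^n\omega(e_j,x_2,\dots,x_p;e_j,y_2,\dots,y_p)$ for any orthonormal basis $(e_j)$ of the tangent space. Suppose that * $g$ is hyper $(2k)$-Einstein, i.e. $c\,R^k=\lambda\,g^{2k-1}$ for some function $\lambda:M\to\mathbb R$, and * $g$ is $k$-conformally flat, i.e. $R^k$ is divisible by the metric: at every point of $M$ there is a double form $\bar\omega$ of degree $2k-1$ with $R^k=g\,\bar\omega$. Then $(M,g)$ has constant $k$-sectional curvature: there is a constant $\kappa\in\mathbb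 R$ such that $$R^k(x_1,\dots,x_{2k};x_1,\dots,x_{2k})=\kappa$$ for every point $m\in M$ and every orthonormal family $x_1,\dots,x_{2k}$ in $T_mM$ (equivalently, the sectional curvature of $R^k$ is the same on all $2k$-dimensional subspaces of all tangent spaces). -/

import Mathlib

open scoped Manifold ContDiff TensorProduct

noncomputable section

/-! ## Double forms on `ℝⁿ`

The tangent spaces of an `n`-manifold are modelled on `EuclideanSpace ℝ (Fin n)`; in the linear
algebra below this space is only used as a vector space with its standard basis, and the scalar
product is an arbitrary bilinear form. -/

/-- The model vector space of the tangent spaces of an `n`-manifold. -/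
abbrev TSpace (n : ℕ) := EuclideanSpace ℝ (Fin n)

/-- The standard basis. -/
abbrev stdBasis (n : ℕ) : Module.Basis (Fin n) ℝ (TSpace n) :=
  (EuclideanSpace.basisFun (Fin n) ℝ).toBasis

/-- The algebra `Λ V*` of exterior forms on `V = ℝⁿ`. -/
abbrev Forms (n : ℕ) := ExteriorAlgebra ℝ (Module.Dual ℝ (TSpace n))

/-- The algebra `𝒟 = Λ V* ⊗ Λ V*` of double forms on `V = ℝⁿ`. Its ring multiplication is the
exterior product of double forms, `(α ⊗ β) (γ ⊗ δ) = (α ∧ γ) ⊗ (β ∧ δ)`. -/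
abbrev DForms (n : ℕ) := Forms n ⊗[ℝ] Forms n

/-- The space `𝒟^{p,p} = Λ^p V* ⊗ Λ^p V*` of double forms of degree `p`. -/
def doubleForms (n p : ℕ) : Submodule ℝ (DForms n) :=
  LinearMap.range (TensorProduct.map
    (⋀[ℝ]^p (Module.Dual ℝ (TSpace n))).subtype (⋀[ℝ]^p (Module.Dual ℝ (TSpace n))).subtype)

/-- The coordinate one-form `dxⁱ`, as an element of `Λ V*`. -/
def dx {n : ℕ} (i : Fin n) : Forms n := ExteriorAlgebra.ι ℝ ((stdBasis n).coord i)

/-- The double form `∑ Bᵢⱼ dxⁱ ⊗ dxʲ` of degree one with components `B`. -/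
def ofComponents₁ {n : ℕ} (B : Fin n → Fin n → ℝ) : DForms n :=
  ∑ i, ∑ j, B i j • (dx i ⊗ₜ[ℝ] dx j)

/-- The double form `¼ ∑ Fᵢⱼₖₗ (dxⁱ ∧ dxʲ) ⊗ (dxᵏ ∧ dxˡ)` of degree two; if `F` is alternating in
its first two and in its last two indices, its value on `(eᵢ, eⱼ; eₖ, eₗ)` is `Fᵢⱼₖₗ`. -/
def ofComponents₂ {n : ℕ} (F : Fin n → Fin n → Fin n → Fin n → ℝ) : DForms n :=
  (1 / 4 : ℝ) • ∑ i, ∑ j, ∑ k, ∑ l, F i j k l • ((dx i * dx j) ⊗ₜ[ℝ] (dx k * dx l))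

/-- The interior product `ι_v : Λ^{p+1} V* → Λ^p V*`, `(ι_v α)(v₁, …, vₚ) = α(v, v₁, …, vₚ)`. -/
def interiorProd {n : ℕ} (v : TSpace n) : Forms n →ₗ[ℝ] Forms n :=
  CliffordAlgebra.contractLeft (Q := (0 : QuadraticForm ℝ (Module.Dual ℝ (TSpace n))))
    (Module.Dual.eval ℝ (TSpace n) v)

/-- The Ricci contraction `c : 𝒟^{p+1,p+1} → 𝒟^{p,p}` with respect to the scalar product with Gram
matrix `G` in the standard basis: `c ω = ∑ Gⁱʲ ω(eᵢ, … ; eⱼ, …)` with `(Gⁱʲ)` the inverse of `G`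
(which is `∑ ω(fᵢ, … ; fᵢ, …)` for any orthonormal basis `f`). -/
def contraction {n : ℕ} (G : Matrix (Fin n) (Fin n) ℝ) : DForms n →ₗ[ℝ] DForms n :=
  ∑ i, ∑ j, G⁻¹ i j •
    TensorProduct.map (interiorProd (stdBasis n i)) (interiorProd (stdBasis n j))

/-- The value `α(x₁, …, xₚ)` of (the degree `p` part of) an exterior form. -/
def evalForm {n : ℕ} : {p : ℕ} → (Fin p → TSpace n) → (Forms n →ₗ[ℝ] ℝ)
  | 0, _ => ExteriorAlgebra.algebraMapInv.toLinearMap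
  | _ + 1, x => evalForm (Fin.tail x) ∘ₗ interiorProd (x 0)

/-- The value `ω(x₁, …, xₚ; y₁, …, yₚ)` of a double form; `(α ⊗ β)(x; y) = α(x) β(y)`. -/
def evalDouble {n p : ℕ} (x y : Fin p → TSpace n) : DForms n →ₗ[ℝ] ℝ :=
  LinearMap.mul' ℝ ℝ ∘ₗ TensorProduct.map (evalForm x) (evalForm y)

/-! ## The curvature of a metric given in coordinates -/

/-- The partial derivative `∂ᵢ f`. -/
def partialDeriv {n : ℕ} (i : Fin n) (f : TSpace n → ℝ) (y : TSpace n) : ℝ :=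
  fderiv ℝ f y (stdBasis n i)

/-- The Christoffel symbols `Γᵏᵢⱼ = ½ ∑ₗ Gᵏˡ (∂ᵢ Gⱼₗ + ∂ⱼ Gᵢₗ - ∂ₗ Gᵢⱼ)`. -/
def christoffel {n : ℕ} (G : TSpace n → Matrix (Fin n) (Fin n) ℝ) (k i j : Fin n)
    (y : TSpace n) : ℝ :=
  (1 / 2 : ℝ) * ∑ l, (G y)⁻¹ k l *
    (partialDeriv i (fun z => G z j l) y + partialDeriv j (fun z => G z i l) y
      - partialDeriv l (fun z => G z i j) y)

/-- The coefficients of the curvature operator of the Levi-Civita connection: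
`(∇ᵢ ∇ⱼ - ∇ⱼ ∇ᵢ) ∂ₖ = ∑ₗ (curvatureCoeff G l i j k) ∂ₗ`. -/
def curvatureCoeff {n : ℕ} (G : TSpace n → Matrix (Fin n) (Fin n) ℝ) (l i j k : Fin n)
    (y : TSpace n) : ℝ :=
  partialDeriv i (christoffel G l j k) y - partialDeriv j (christoffel G l i k) y
    + ∑ m, (christoffel G l i m y * christoffel G m j k y
      - christoffel G l j m y * christoffel G m i k y)

/-- The covariant curvature tensor `Rᵢⱼₖₗ = ⟨(∇ᵢ ∇ⱼ - ∇ⱼ ∇ᵢ) ∂ₗ, ∂ₖ⟩`, with the sign for which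
`R(u, v, u, v)` is the sectional curvature of an orthonormal pair `u, v`. -/
def curvatureComponents {n : ℕ} (G : TSpace n → Matrix (Fin n) (Fin n) ℝ) (y : TSpace n)
    (i j k l : Fin n) : ℝ :=
  ∑ m, G y k m * curvatureCoeff G m i j l y

/-! ## Riemannian manifolds -/

section Manifold

variable {n : ℕ} {M : Type*} [TopologicalSpace M] [ChartedSpace (TSpace n) M]
  [IsManifold (𝓡 n) ∞ M]

/-- Smooth Riemannian metrics on the `n`-manifold `M`. -/
abbrev SmoothMetric (n : ℕ) (M : Type*) [TopologicalSpace M] [ChartedSpace (TSpace n) M]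
    [IsManifold (𝓡 n) ∞ M] :=
  Bundle.ContMDiffRiemannianMetric (𝓡 n) ∞ (TSpace n) (fun m : M => TangentSpace (𝓡 n) m)

/-- The matrix `Gᵢⱼ(y) = g(∂ᵢ, ∂ⱼ)` of the metric in the preferred chart at `m`, as a function of
the coordinates `y`. -/
def metricInChart (g : SmoothMetric n M) (m : M) (y : TSpace n) : Matrix (Fin n) (Fin n) ℝ :=
  Matrix.of fun i j =>
    g.inner ((extChartAt (𝓡 n) m).symm y)
      (mfderiv 𝓘(ℝ, TSpace n) (𝓡 n) (extChartAt (𝓡 n) m).symm y (stdBasis n i))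
      (mfderiv 𝓘(ℝ, TSpace n) (𝓡 n) (extChartAt (𝓡 n) m).symm y (stdBasis n j))

/-- The Gram matrix of `g` on `T_m M`. In Mathlib `T_m M` is the model space by means of the
preferred chart at `m`, so the standard basis of `T_m M` consists of the coordinate vectors of
that chart at `m`. -/
def gramAt (g : SmoothMetric n M) (m : M) : Matrix (Fin n) (Fin n) ℝ :=
  Matrix.of fun i j => g.inner m (stdBasis n i : TSpace n) (stdBasis n j : TSpace n)

/-- The metric at `m`, as a double form of degree one. -/
def metricForm (g : SmoothMetric n M) (m : M) : DForms n := ofComponents₁ (gramAt g m)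

/-- The Riemann covariant curvature tensor at `m`, as a double form of degree two. -/
def riemannForm (g : SmoothMetric n M) (m : M) : DForms n :=
  ofComponents₂ (curvatureComponents (metricInChart g m) (extChartAt (𝓡 n) m m))

/-- The first contraction of double forms at `m`. -/
def contractionAt (g : SmoothMetric n M) (m : M) : DForms n →ₗ[ℝ] DForms n :=
  contraction (gramAt g m)

/-- Thorpe's curvature tensor `R^k` at `m`: the `k`-th exterior power of the double form `R`. -/
def thorpe (g : SmoothMetric n M) (k : ℕ) (m : M) : DForms n := riemannForm g m ^ k

/-- `g` is hyper `(2k)`-Einstein: `c R^k = λ g^{2k-1}` for a function `λ` on `M`. -/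
def IsHyperEinstein (g : SmoothMetric n M) (k : ℕ) : Prop :=
  ∃ lam : M → ℝ, ∀ m : M,
    contractionAt g m (thorpe g k m) = lam m • metricForm g m ^ (2 * k - 1)

/-- `g` is `k`-conformally flat: `R^k` is divisible by `g`, that is at every point `R^k = g θ` with
a double form `θ` of degree `2k - 1`. -/
def IsConformallyFlatOfOrder (g : SmoothMetric n M) (k : ℕ) : Prop :=
  ∀ m : M, ∃ θ ∈ doubleForms n (2 * k - 1), thorpe g k m = metricForm g m * θ

/-- `g` has constant `k`-sectional curvature: there is one constant `κ` such that, for every point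
`m` and every `2k`-dimensional subspace of `T_m M`, with orthonormal basis `x₁, …, x₂ₖ`, one has
`R^k(x₁, …, x₂ₖ; x₁, …, x₂ₖ) = κ`. -/
def HasConstantSectionalCurvatureOfOrder (g : SmoothMetric n M) (k : ℕ) : Prop :=
  ∃ κ : ℝ, ∀ (m : M) (x : Fin (2 * k) → TangentSpace (𝓡 n) m),
    (∀ i j, g.inner m (x i) (x j) = if i = j then 1 else 0) →
      evalDouble (n := n) x x (thorpe g k m) = κ

end Manifold

end

noncomputable section

/-! ## Operators on double forms -/

section Algebra

variable {n : ℕ}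

/-! At a single point the argument is linear algebra. For the scalar product of double forms that
sums over all components in an orthonormal basis, multiplication by `g` is adjoint to the
contraction `c`, up to a positive factor (`doublePairing_basisMetric_mul`). Hence a double form `g
θ` with `c (g θ) = 0` has norm zero and vanishes. Since `c g^(p+1) = (p+1)(n-p) g^p`, subtracting a
suitable multiple of `g^(2k)` from `R^k = g θ` leaves a form that is still divisible by `g` and has
zero contraction. So `R^k = μ g^(2k)` (`exists_eq_smul_basisMetric_pow`), and on orthonormal
families `g^(2k)` takes the value `(2k)!`.

That `μ` is the same at all points is Schur's lemma. In coordinates whose Christoffel symbols vanish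
at the point, the derivative of `g` vanishes there, and since `R` is central, `∂ₘμ g^(2k) = k
R^(k-1) ∂ₘR`. Multiplying by `dxᵐ` in the first factor and summing over `m`, the second Bianchi
identity gives `dμ g^(2k) = 0`. Contraction strips off the powers of `g` because `2k < n`, so `dμ =
0` (`schur_of_christoffel_eq_zero`), and connectedness makes `μ` constant.

The curvature form at a point is computed in the preferred chart of that very point, so comparing
neighbouring points requires naturality of the curvature (`curvatureOperator_transform`,
`IsMetricPullback.pullback_riemann`). It serves twice: for transition maps between charts, and for
passing to coordinates with vanishing Christoffel symbols. -/

theorem interiorProd_ι_mul (v : TSpace n) (ξ : Module.Dual ℝ (TSpace n)) (α : Forms n) :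
    interiorProd v (ExteriorAlgebra.ι ℝ ξ * α) =
      ξ v • α - ExteriorAlgebra.ι ℝ ξ * interiorProd v α :=
  CliffordAlgebra.contractLeft_ι_mul (Q := 0) _ _ _

theorem interiorProd_one (v : TSpace n) : interiorProd v (1 : Forms n) = 0 :=
  CliffordAlgebra.contractLeft_one (Q := 0) _

theorem interiorProd_algebraMap (v : TSpace n) (r : ℝ) :
    interiorProd v (algebraMap ℝ (Forms n) r) = 0 :=
  CliffordAlgebra.contractLeft_algebraMap (Q := 0) _ _

theorem interiorProd_comm (v w : TSpace n) (α : Forms n) :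
    interiorProd v (interiorProd w α) = -interiorProd w (interiorProd v α) :=
  CliffordAlgebra.contractLeft_comm (Q := 0) _ _ _

theorem ι_mul_ι_comm (ξ η : Module.Dual ℝ (TSpace n)) :
    (ExteriorAlgebra.ι ℝ ξ * ExteriorAlgebra.ι ℝ η : Forms n) =
      -(ExteriorAlgebra.ι ℝ η * ExteriorAlgebra.ι ℝ ξ) :=
  eq_neg_of_add_eq_zero_left (ExteriorAlgebra.ι_add_mul_swap ξ η)

/-- The one-form `ξ` in the first factor. -/
def leftForm (ξ : Module.Dual ℝ (TSpace n)) : DForms n := ExteriorAlgebra.ι ℝ ξ ⊗ₜ[ℝ] 1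

/-- The one-form `ξ` in the second factor. -/
def rightForm (ξ : Module.Dual ℝ (TSpace n)) : DForms n := 1 ⊗ₜ[ℝ] ExteriorAlgebra.ι ℝ ξ

/-- The interior product in the first factor. -/
def leftInterior (v : TSpace n) : DForms n →ₗ[ℝ] DForms n :=
  TensorProduct.map (interiorProd v) LinearMap.id

/-- The interior product in the second factor. -/
def rightInterior (v : TSpace n) : DForms n →ₗ[ℝ] DForms n :=
  TensorProduct.map LinearMap.id (interiorProd v)

theorem leftForm_mul_rightForm (ξ η : Module.Dual ℝ (TSpace n)) :
    leftForm ξ * rightForm η = ExteriorAlgebra.ι ℝ ξ ⊗ₜ[ℝ] ExteriorAlgebra.ι ℝ η := by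
  simp [leftForm, rightForm]

theorem rightForm_mul_leftForm (ξ η : Module.Dual ℝ (TSpace n)) :
    rightForm η * leftForm ξ = leftForm ξ * rightForm η := by
  simp [leftForm, rightForm]

theorem leftForm_mul_leftForm (ξ η : Module.Dual ℝ (TSpace n)) :
    leftForm ξ * leftForm η = -(leftForm η * leftForm ξ) := by
  simp [leftForm, ι_mul_ι_comm ξ η, TensorProduct.neg_tmul]

theorem rightForm_mul_rightForm (ξ η : Module.Dual ℝ (TSpace n)) :
    rightForm ξ * rightForm η = -(rightForm η * rightForm ξ) := by
  simp [rightForm, ι_mul_ι_comm ξ η, TensorProduct.tmul_neg]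

theorem map_interiorProd (v w : TSpace n) (Ω : DForms n) :
    TensorProduct.map (interiorProd v) (interiorProd w) Ω =
      leftInterior v (rightInterior w Ω) := by
  rw [leftInterior, rightInterior, ← LinearMap.comp_apply, ← TensorProduct.map_comp]
  simp

theorem leftInterior_leftForm_mul (v : TSpace n) (ξ : Module.Dual ℝ (TSpace n)) (Ω : DForms n) :
    leftInterior v (leftForm ξ * Ω) = ξ v • Ω - leftForm ξ * leftInterior v Ω := by
  induction Ω using TensorProduct.induction_on with
  | zero => simp
  | tmul α β =>
    simp [leftInterior, leftForm, interiorProd_ι_mul, TensorProduct.sub_tmul,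
      TensorProduct.smul_tmul']
  | add a b ha hb => simp only [mul_add, map_add, smul_add, ha, hb]; abel

theorem rightInterior_rightForm_mul (v : TSpace n) (ξ : Module.Dual ℝ (TSpace n))
    (Ω : DForms n) :
    rightInterior v (rightForm ξ * Ω) = ξ v • Ω - rightForm ξ * rightInterior v Ω := by
  induction Ω using TensorProduct.induction_on with
  | zero => simp
  | tmul α β =>
    simp [rightInterior, rightForm, interiorProd_ι_mul, TensorProduct.tmul_sub]
  | add a b ha hb => simp only [mul_add, map_add, smul_add, ha, hb]; abel

theorem leftInterior_rightForm_mul (v : TSpace n) (ξ : Module.Dual ℝ (TSpace n))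
    (Ω : DForms n) : leftInterior v (rightForm ξ * Ω) = rightForm ξ * leftInterior v Ω := by
  induction Ω using TensorProduct.induction_on with
  | zero => simp
  | tmul α β => simp [leftInterior, rightForm]
  | add a b ha hb => simp only [mul_add, map_add, ha, hb]

theorem rightInterior_leftForm_mul (v : TSpace n) (ξ : Module.Dual ℝ (TSpace n))
    (Ω : DForms n) : rightInterior v (leftForm ξ * Ω) = leftForm ξ * rightInterior v Ω := by
  induction Ω using TensorProduct.induction_on with
  | zero => simp
  | tmul α β => simp [rightInterior, leftForm]
  | add a b ha hb => simp only [mul_add, map_add, ha, hb]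

theorem rightInterior_leftInterior (v w : TSpace n) (Ω : DForms n) :
    rightInterior w (leftInterior v Ω) = leftInterior v (rightInterior w Ω) := by
  induction Ω using TensorProduct.induction_on with
  | zero => simp
  | tmul α β => simp [rightInterior, leftInterior]
  | add a b ha hb => simp only [map_add, ha, hb]

theorem leftInterior_one (v : TSpace n) : leftInterior v (1 : DForms n) = 0 := by
  simp [leftInterior, Algebra.TensorProduct.one_def, interiorProd_one]

theorem rightInterior_one (v : TSpace n) : rightInterior v (1 : DForms n) = 0 := by
  simp [rightInterior, Algebra.TensorProduct.one_def, interiorProd_one]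

/-! ### The metric with a given orthonormal basis -/

variable (b : Module.Basis (Fin n) ℝ (TSpace n))

/-- The scalar product with orthonormal basis `b`, as a double form. -/
def basisMetric : DForms n := ∑ i, leftForm (b.coord i) * rightForm (b.coord i)

/-- The Ricci contraction of the scalar product with orthonormal basis `b`. -/
def basisContraction : DForms n →ₗ[ℝ] DForms n :=
  ∑ i, TensorProduct.map (interiorProd (b i)) (interiorProd (b i))

/-- The degree operator of the first factor. -/
def leftDegree (Ω : DForms n) : DForms n := ∑ i, leftForm (b.coord i) * leftInterior (b i) Ω

/-- The degree operator of the second factor. -/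
def rightDegree (Ω : DForms n) : DForms n := ∑ i, rightForm (b.coord i) * rightInterior (b i) Ω

theorem basisContraction_apply (Ω : DForms n) :
    basisContraction b Ω = ∑ i, leftInterior (b i) (rightInterior (b i) Ω) := by
  simp [basisContraction, LinearMap.sum_apply, map_interiorProd]

/-- The covector `b`-dual to a vector. -/
def flat (v : TSpace n) : Module.Dual ℝ (TSpace n) := ∑ i, b.repr v i • b.coord i

theorem flat_apply (v w : TSpace n) : flat b v w = ∑ i, b.repr v i * b.repr w i := by
  simp [flat, LinearMap.sum_apply]

theorem flat_basis (i : Fin n) : flat b (b i) = b.coord i := by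
  simp [flat, Finsupp.single_apply]

theorem leftForm_sum {ι : Type*} (s : Finset ι) (f : ι → Module.Dual ℝ (TSpace n)) :
    leftForm (∑ i ∈ s, f i) = ∑ i ∈ s, leftForm (f i) := by
  simp [leftForm, TensorProduct.sum_tmul]

theorem rightForm_sum {ι : Type*} (s : Finset ι) (f : ι → Module.Dual ℝ (TSpace n)) :
    rightForm (∑ i ∈ s, f i) = ∑ i ∈ s, rightForm (f i) := by
  simp [rightForm, TensorProduct.tmul_sum]

theorem leftForm_smul (r : ℝ) (ξ : Module.Dual ℝ (TSpace n)) :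
    leftForm (r • ξ) = r • leftForm ξ := by
  simp [leftForm, TensorProduct.smul_tmul']

theorem rightForm_smul (r : ℝ) (ξ : Module.Dual ℝ (TSpace n)) :
    rightForm (r • ξ) = r • rightForm ξ := by
  simp [rightForm]

theorem leftForm_mul_basisMetric (ξ : Module.Dual ℝ (TSpace n)) :
    leftForm ξ * basisMetric b = -(basisMetric b * leftForm ξ) := by
  simp only [basisMetric, Finset.mul_sum, Finset.sum_mul, ← Finset.sum_neg_distrib]
  refine Finset.sum_congr rfl fun i _ => ?_
  rw [← mul_assoc, leftForm_mul_leftForm, mul_assoc, rightForm_mul_leftForm, neg_mul, mul_assoc]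

theorem rightForm_mul_basisMetric (ξ : Module.Dual ℝ (TSpace n)) :
    rightForm ξ * basisMetric b = -(basisMetric b * rightForm ξ) := by
  simp only [basisMetric, Finset.mul_sum, Finset.sum_mul, ← Finset.sum_neg_distrib]
  refine Finset.sum_congr rfl fun i _ => ?_
  rw [← mul_assoc, rightForm_mul_leftForm, mul_assoc, rightForm_mul_rightForm, mul_neg, mul_assoc]

/-- The interior product is an antiderivation in the first factor, where `g` has degree one;
contracting `g` there with `v` leaves the dual covector of `v` in the second factor. -/
theorem leftInterior_basisMetric_mul (v : TSpace n) (Ω : DForms n) :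
    leftInterior v (basisMetric b * Ω) =
      rightForm (flat b v) * Ω - basisMetric b * leftInterior v Ω := by
  simp only [basisMetric, flat, rightForm_sum, rightForm_smul, Finset.sum_mul, map_sum,
    ← Finset.sum_sub_distrib]
  refine Finset.sum_congr rfl fun i _ => ?_
  rw [mul_assoc, leftInterior_leftForm_mul, leftInterior_rightForm_mul]
  simp [mul_assoc]

theorem rightInterior_basisMetric_mul (v : TSpace n) (Ω : DForms n) :
    rightInterior v (basisMetric b * Ω) =
      leftForm (flat b v) * Ω - basisMetric b * rightInterior v Ω := by
  simp only [basisMetric, flat, leftForm_sum, leftForm_smul, Finset.sum_mul, map_sum,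
    ← Finset.sum_sub_distrib]
  refine Finset.sum_congr rfl fun i _ => ?_
  rw [← rightForm_mul_leftForm, mul_assoc, rightInterior_rightForm_mul, rightInterior_leftForm_mul]
  simp [mul_assoc]

/-- The commutator of `c` and multiplication by `g` is `n` minus the two degree operators: the
diagonal terms `bⁱ(bᵢ)` add up to `n`, and the cross terms are the degree operators. -/
theorem basisContraction_basisMetric_mul (Ω : DForms n) :
    basisContraction b (basisMetric b * Ω) =
      (n : ℝ) • Ω - leftDegree b Ω - rightDegree b Ω + basisMetric b * basisContraction b Ω := by
  have key : ∀ i, leftInterior (b i) (rightInterior (b i) (basisMetric b * Ω)) =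
      Ω - leftForm (b.coord i) * leftInterior (b i) Ω
        - rightForm (b.coord i) * rightInterior (b i) Ω
        + basisMetric b * leftInterior (b i) (rightInterior (b i) Ω) := by
    intro i
    rw [rightInterior_basisMetric_mul, map_sub, leftInterior_leftForm_mul,
      leftInterior_basisMetric_mul, flat_basis]
    simp only [Module.Basis.coord_apply, Module.Basis.repr_self, Finsupp.single_eq_same, one_smul]
    abel
  rw [basisContraction_apply, basisContraction_apply, Finset.sum_congr rfl fun i _ => key i]
  simp [Finset.sum_add_distrib, Finset.sum_sub_distrib, leftDegree, rightDegree, Finset.mul_sum,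
    ← Nat.cast_smul_eq_nsmul ℝ]

theorem leftDegree_basisMetric_mul (Ω : DForms n) :
    leftDegree b (basisMetric b * Ω) = basisMetric b * Ω + basisMetric b * leftDegree b Ω := by
  have key : ∀ i, leftForm (b.coord i) * leftInterior (b i) (basisMetric b * Ω) =
      leftForm (b.coord i) * rightForm (b.coord i) * Ω
        + basisMetric b * (leftForm (b.coord i) * leftInterior (b i) Ω) := by
    intro i
    rw [leftInterior_basisMetric_mul, flat_basis, mul_sub, ← mul_assoc _ (basisMetric b),
      leftForm_mul_basisMetric]
    simp [mul_assoc]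
  rw [leftDegree, Finset.sum_congr rfl fun i _ => key i, Finset.sum_add_distrib,
    ← Finset.sum_mul, ← Finset.mul_sum]
  rfl

theorem rightDegree_basisMetric_mul (Ω : DForms n) :
    rightDegree b (basisMetric b * Ω) = basisMetric b * Ω + basisMetric b * rightDegree b Ω := by
  have key : ∀ i, rightForm (b.coord i) * rightInterior (b i) (basisMetric b * Ω) =
      leftForm (b.coord i) * rightForm (b.coord i) * Ω
        + basisMetric b * (rightForm (b.coord i) * rightInterior (b i) Ω) := by
    intro i
    rw [rightInterior_basisMetric_mul, flat_basis, mul_sub, ← mul_assoc _ (basisMetric b),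
      rightForm_mul_basisMetric, ← mul_assoc, rightForm_mul_leftForm]
    simp [mul_assoc]
  rw [rightDegree, Finset.sum_congr rfl fun i _ => key i, Finset.sum_add_distrib,
    ← Finset.sum_mul, ← Finset.mul_sum]
  rfl

/-! ### Powers of the metric under interior products and contraction -/

theorem leftDegree_pow (p : ℕ) :
    leftDegree b (basisMetric b ^ p) = (p : ℝ) • basisMetric b ^ p := by
  induction p with
  | zero => simp [leftDegree, leftInterior_one]
  | succ p ih =>
    rw [pow_succ', leftDegree_basisMetric_mul, ih]
    push_cast
    rw [mul_smul_comm, add_smul, one_smul, add_comm]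

theorem rightDegree_pow (p : ℕ) :
    rightDegree b (basisMetric b ^ p) = (p : ℝ) • basisMetric b ^ p := by
  induction p with
  | zero => simp [rightDegree, rightInterior_one]
  | succ p ih =>
    rw [pow_succ', rightDegree_basisMetric_mul, ih]
    push_cast
    rw [mul_smul_comm, add_smul, one_smul, add_comm]

/-- Moving `c` past one factor `g` after another contributes `n - 2j` for `j = 0, …, p`, and these
add up to `(p+1)(n-p)`. -/
theorem basisContraction_pow_succ (p : ℕ) :
    basisContraction b (basisMetric b ^ (p + 1)) =
      ((p + 1) * (n - p) : ℝ) • basisMetric b ^ p := by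
  induction p with
  | zero =>
    have h := basisContraction_basisMetric_mul b 1
    simp [basisContraction_apply, leftDegree, rightDegree, leftInterior_one,
      rightInterior_one] at h
    simp [basisContraction_apply, h]
  | succ p ih =>
    rw [pow_succ', basisContraction_basisMetric_mul, ih, leftDegree_pow, rightDegree_pow,
      mul_smul_comm, ← pow_succ', ← sub_smul, ← sub_smul, ← add_smul]
    congr 1
    push_cast
    ring

theorem leftInterior_pow (v : TSpace n) (p : ℕ) :
    leftInterior v (basisMetric b ^ (p + 1)) =
      (p + 1 : ℝ) • (rightForm (flat b v) * basisMetric b ^ p) := by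
  induction p with
  | zero =>
    have h := leftInterior_basisMetric_mul b v 1
    simpa [leftInterior_one] using h
  | succ p ih =>
    rw [pow_succ', leftInterior_basisMetric_mul, ih, mul_smul_comm, ← mul_assoc (basisMetric b),
      ← neg_eq_iff_eq_neg.2 (rightForm_mul_basisMetric b (flat b v)), neg_mul, mul_assoc,
      ← pow_succ']
    push_cast
    simp only [smul_neg, sub_neg_eq_add, add_smul, one_smul]
    abel

theorem rightInterior_pow (v : TSpace n) (p : ℕ) :
    rightInterior v (basisMetric b ^ (p + 1)) =
      (p + 1 : ℝ) • (leftForm (flat b v) * basisMetric b ^ p) := by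
  induction p with
  | zero =>
    have h := rightInterior_basisMetric_mul b v 1
    simpa [rightInterior_one] using h
  | succ p ih =>
    rw [pow_succ', rightInterior_basisMetric_mul, ih, mul_smul_comm, ← mul_assoc (basisMetric b),
      ← neg_eq_iff_eq_neg.2 (leftForm_mul_basisMetric b (flat b v)), neg_mul, mul_assoc,
      ← pow_succ']
    push_cast
    simp only [smul_neg, sub_neg_eq_add, add_smul, one_smul]
    abel

theorem exists_flat_eq (ξ : Module.Dual ℝ (TSpace n)) : ∃ v, flat b v = ξ := by
  refine ⟨∑ i, ξ (b i) • b i, b.ext fun j => ?_⟩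
  simp [flat_apply, Finsupp.single_apply]

/-- The contraction of `ξ gᵖ` for a one-form `ξ` in the first factor. -/
theorem basisContraction_leftForm_mul_pow (ξ : Module.Dual ℝ (TSpace n)) (p : ℕ) :
    basisContraction b (leftForm ξ * basisMetric b ^ (p + 1)) =
      (-((p + 1) * (n - (p + 1))) : ℝ) • (leftForm ξ * basisMetric b ^ p) := by
  obtain ⟨v, rfl⟩ := exists_flat_eq b ξ
  have key : ∀ i, leftInterior (b i) (rightInterior (b i)
      (leftForm (flat b v) * basisMetric b ^ (p + 1))) =
      (flat b v (b i)) • rightInterior (b i) (basisMetric b ^ (p + 1)) -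
        leftForm (flat b v) *
          leftInterior (b i) (rightInterior (b i) (basisMetric b ^ (p + 1))) := by
    intro i
    rw [rightInterior_leftForm_mul, leftInterior_leftForm_mul]
  rw [basisContraction_apply, Finset.sum_congr rfl fun i _ => key i, Finset.sum_sub_distrib,
    ← Finset.mul_sum, ← basisContraction_apply, basisContraction_pow_succ]
  simp only [rightInterior_pow, flat_basis]
  -- The sum reassembles the one-form itself; this extra `p + 1` lowers the factor `n - p` from
  -- `basisContraction_pow_succ` to `n - (p + 1)`.
  have h2 : ∑ i, flat b v (b i) • (p + 1 : ℝ) • (leftForm (b.coord i) * basisMetric b ^ p) =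
      (p + 1 : ℝ) • (leftForm (flat b v) * basisMetric b ^ p) := by
    conv_rhs => rw [flat, leftForm_sum, Finset.sum_mul, Finset.smul_sum]
    refine Finset.sum_congr rfl fun i _ => ?_
    rw [leftForm_smul, smul_comm, smul_mul_assoc, flat_apply]
    simp [Finsupp.single_apply]
  rw [h2, mul_smul_comm, ← sub_smul]
  congr 1
  ring

theorem leftForm_injective : Function.Injective (leftForm (n := n)) := by
  intro ξ η h
  refine (stdBasis n).ext fun i => ?_
  have := congrArg (leftInterior (n := n) (stdBasis n i)) h
  have e : ∀ ζ : Module.Dual ℝ (TSpace n), leftInterior (stdBasis n i) (leftForm ζ) =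
      algebraMap ℝ (DForms n) (ζ (stdBasis n i)) := by
    intro ζ
    have := leftInterior_leftForm_mul (stdBasis n i) ζ 1
    simpa [leftInterior_one, Algebra.algebraMap_eq_smul_one] using this
  rw [e, e] at this
  simpa using FaithfulSMul.algebraMap_injective ℝ (DForms n) this

/-- Each contraction removes one factor `g` at the cost of a scalar that is nonzero while `p + 1 <
n`, until only `ξ` is left. This is where Schur's lemma needs the degree to be below the dimension.
-/
theorem eq_zero_of_leftForm_mul_pow_eq_zero {p : ℕ} (hp : p < n)
    (ξ : Module.Dual ℝ (TSpace n)) (h : leftForm ξ * basisMetric b ^ p = 0) : ξ = 0 := by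
  induction p with
  | zero =>
    apply leftForm_injective
    simpa [leftForm] using h
  | succ p ih =>
    apply ih (by omega)
    have h1 := basisContraction_leftForm_mul_pow b ξ p
    rw [h, map_zero, eq_comm, smul_eq_zero] at h1
    refine h1.resolve_left ?_
    have : ((p + 1 : ℕ) : ℝ) < n := by exact_mod_cast hp
    push_cast at this
    have h3 : (0 : ℝ) < p + 1 := by positivity
    exact neg_ne_zero.2 (mul_ne_zero h3.ne' (by linarith))

theorem basisMetric_pow_ne_zero {p : ℕ} (hp : p ≤ n) : basisMetric b ^ p ≠ 0 := by
  induction p with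
  | zero => simp
  | succ p ih =>
    intro h
    have h1 := basisContraction_pow_succ b p
    rw [h, map_zero, eq_comm, smul_eq_zero] at h1
    refine ih (by omega) (h1.resolve_left ?_)
    have : ((p + 1 : ℕ) : ℝ) ≤ n := by exact_mod_cast hp
    push_cast at this
    have h3 : (0 : ℝ) < p + 1 := by positivity
    exact mul_ne_zero h3.ne' (by linarith)

end Algebra

/-! ### Evaluation of double forms and the induced scalar product -/

section Evaluation

variable {n : ℕ} (b : Module.Basis (Fin n) ℝ (TSpace n))

theorem evalForm_zero (x : Fin 0 → TSpace n) (α : Forms n) :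
    evalForm x α = ExteriorAlgebra.algebraMapInv α := rfl

theorem evalDouble_tmul {p : ℕ} (x y : Fin p → TSpace n) (α β : Forms n) :
    evalDouble x y (α ⊗ₜ[ℝ] β) = evalForm x α * evalForm y β := rfl

theorem evalDouble_succ {p : ℕ} (x y : Fin (p + 1) → TSpace n) (Ω : DForms n) :
    evalDouble x y Ω =
      evalDouble (Fin.tail x) (Fin.tail y) (leftInterior (x 0) (rightInterior (y 0) Ω)) := by
  induction Ω using TensorProduct.induction_on with
  | zero => simp
  | tmul α β => rfl
  | add a b ha hb => simp only [map_add, ha, hb]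

/-- The scalar product of exterior forms of degree `p` for which `b` is orthonormal, up to a
factor. -/
def formPairing (p : ℕ) : LinearMap.BilinForm ℝ (Forms n) :=
  ∑ I : Fin p → Fin n, LinearMap.BilinForm.linMulLin (evalForm (b ∘ I)) (evalForm (b ∘ I))

theorem formPairing_apply (p : ℕ) (α η : Forms n) :
    formPairing b p α η = ∑ I : Fin p → Fin n, evalForm (b ∘ I) α * evalForm (b ∘ I) η := by
  simp [formPairing, LinearMap.sum_apply]

theorem formPairing_succ (p : ℕ) (α η : Forms n) :
    formPairing b (p + 1) α η =
      ∑ i, formPairing b p (interiorProd (b i) α) (interiorProd (b i) η) := by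
  simp only [formPairing_apply]
  rw [← Fintype.sum_prod_type', ← (Fin.consEquiv fun _ : Fin (p + 1) => Fin n).sum_comp]
  rfl

theorem formPairing_zero_ι_mul (ξ : Module.Dual ℝ (TSpace n)) (α η : Forms n) :
    formPairing b 0 (ExteriorAlgebra.ι ℝ ξ * α) η = 0 := by
  simp [formPairing_apply, evalForm_zero, ExteriorAlgebra.algebraMapInv]

/-- Exterior multiplication is adjoint to the interior product; the factor `p + 1` appears because
the pairing runs over all index tuples, not only increasing ones. Splitting off the first index
gives one copy of the right-hand pairing, and the remaining terms give `p` more by induction, the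
sign of the antiderivation cancelling that of swapping two interior products. -/
theorem formPairing_ι_mul (p : ℕ) (a : Fin n) (α η : Forms n) :
    formPairing b (p + 1) (ExteriorAlgebra.ι ℝ (b.coord a) * α) η =
      (p + 1 : ℝ) * formPairing b p α (interiorProd (b a) η) := by
  have step : ∀ (p : ℕ) (α η : Forms n),
      formPairing b (p + 1) (ExteriorAlgebra.ι ℝ (b.coord a) * α) η =
        formPairing b p α (interiorProd (b a) η) -
          ∑ i, formPairing b p (ExteriorAlgebra.ι ℝ (b.coord a) * interiorProd (b i) α)
            (interiorProd (b i) η) := by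
    intro p α η
    rw [formPairing_succ]
    simp only [interiorProd_ι_mul, map_sub, LinearMap.sub_apply, Finset.sum_sub_distrib, map_smul,
      LinearMap.smul_apply, Module.Basis.coord_apply, Module.Basis.repr_self]
    simp [Finsupp.single_apply]
  induction p generalizing α η with
  | zero => simp [step, formPairing_zero_ι_mul]
  | succ p ih =>
    rw [step]
    simp only [ih, interiorProd_comm (b a) (b _) η, map_neg]
    rw [← Finset.mul_sum, Finset.sum_neg_distrib, ← formPairing_succ]
    push_cast
    ring

/-- The scalar product of double forms for which `b` is orthonormal, up to a factor. -/
def doublePairing (p : ℕ) : LinearMap.BilinForm ℝ (DForms n) :=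
  ∑ I : Fin p → Fin n, ∑ J : Fin p → Fin n,
    LinearMap.BilinForm.linMulLin (evalDouble (b ∘ I) (b ∘ J)) (evalDouble (b ∘ I) (b ∘ J))

theorem doublePairing_apply (p : ℕ) (Ω Η : DForms n) :
    doublePairing b p Ω Η = ∑ I : Fin p → Fin n, ∑ J : Fin p → Fin n,
      evalDouble (b ∘ I) (b ∘ J) Ω * evalDouble (b ∘ I) (b ∘ J) Η := by
  simp [doublePairing, LinearMap.sum_apply]

theorem doublePairing_tmul (p : ℕ) (α β γ δ : Forms n) :
    doublePairing b p (α ⊗ₜ[ℝ] β) (γ ⊗ₜ[ℝ] δ) =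
      formPairing b p α γ * formPairing b p β δ := by
  rw [doublePairing_apply, formPairing_apply, formPairing_apply, Finset.sum_mul_sum]
  refine Finset.sum_congr rfl fun I _ => Finset.sum_congr rfl fun J _ => ?_
  rw [evalDouble_tmul, evalDouble_tmul]
  ring

theorem doublePairing_leftForm_mul_rightForm_mul (p : ℕ) (a : Fin n) (Ω Η : DForms n) :
    doublePairing b (p + 1) (leftForm (b.coord a) * rightForm (b.coord a) * Ω) Η =
      (p + 1 : ℝ) ^ 2 * doublePairing b p Ω (leftInterior (b a) (rightInterior (b a) Η)) := by
  induction Ω using TensorProduct.induction_on with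
  | zero => simp
  | add x y hx hy => simp only [mul_add, map_add, LinearMap.add_apply, hx, hy]
  | tmul α β =>
    induction Η using TensorProduct.induction_on with
    | zero => simp
    | add x y hx hy => simp only [mul_add, map_add, hx, hy]
    | tmul γ δ =>
      rw [leftForm_mul_rightForm, Algebra.TensorProduct.tmul_mul_tmul, doublePairing_tmul,
        formPairing_ι_mul, formPairing_ι_mul, ← map_interiorProd, TensorProduct.map_tmul,
        doublePairing_tmul]
      ring

/-- Multiplication by the metric is adjoint to the contraction. -/
theorem doublePairing_basisMetric_mul (p : ℕ) (Ω Η : DForms n) :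
    doublePairing b (p + 1) (basisMetric b * Ω) Η =
      (p + 1 : ℝ) ^ 2 * doublePairing b p Ω (basisContraction b Η) := by
  simp only [basisMetric, Finset.sum_mul, map_sum, LinearMap.sum_apply,
    doublePairing_leftForm_mul_rightForm_mul, basisContraction_apply, Finset.mul_sum]

/-- By adjointness the square norm of `g θ` is a multiple of the pairing of `θ` with `c (g θ) = 0`;
a vanishing sum of squares has vanishing terms. -/
theorem evalDouble_eq_zero_of_basisContraction_eq_zero (p : ℕ) (θ : DForms n)
    (h : basisContraction b (basisMetric b * θ) = 0) (I J : Fin (p + 1) → Fin n) :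
    evalDouble (b ∘ I) (b ∘ J) (basisMetric b * θ) = 0 := by
  have h1 := doublePairing_basisMetric_mul b p θ (basisMetric b * θ)
  rw [h, map_zero, mul_zero, doublePairing_apply] at h1
  rw [Finset.sum_eq_zero_iff_of_nonneg
    fun I _ => Finset.sum_nonneg fun J _ => mul_self_nonneg _] at h1
  have h2 := h1 I (Finset.mem_univ _)
  rw [Finset.sum_eq_zero_iff_of_nonneg fun J _ => mul_self_nonneg _] at h2
  exact mul_self_eq_zero.1 (h2 J (Finset.mem_univ _))

/-! ### Degrees -/

theorem ι_mul_mem {p : ℕ} (ξ : Module.Dual ℝ (TSpace n)) {α : Forms n}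
    (h : α ∈ ⋀[ℝ]^p (Module.Dual ℝ (TSpace n))) :
    ExteriorAlgebra.ι ℝ ξ * α ∈ ⋀[ℝ]^(p + 1) (Module.Dual ℝ (TSpace n)) := by
  rw [ExteriorAlgebra.exteriorPower, pow_succ']
  exact Submodule.mul_mem_mul ⟨ξ, rfl⟩ h

/-- The exterior power is by definition a power of the submodule of one-forms, so splitting off one
factor gives additive generators `ξ ∧ α`. -/
theorem exteriorPower_succ_induction {p : ℕ} {P : Forms n → Prop}
    (hadd : ∀ α β, P α → P β → P (α + β))
    (hmul : ∀ ξ : Module.Dual ℝ (TSpace n), ∀ α ∈ ⋀[ℝ]^p (Module.Dual ℝ (TSpace n)),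
      P (ExteriorAlgebra.ι ℝ ξ * α)) {α : Forms n}
    (h : α ∈ ⋀[ℝ]^(p + 1) (Module.Dual ℝ (TSpace n))) : P α := by
  rw [ExteriorAlgebra.exteriorPower, pow_succ'] at h
  refine Submodule.mul_induction_on h ?_ hadd
  rintro _ ⟨ξ, rfl⟩ α hα
  exact hmul ξ α hα

theorem exists_algebraMap_of_mem_zero {α : Forms n}
    (h : α ∈ ⋀[ℝ]^0 (Module.Dual ℝ (TSpace n))) : ∃ r, algebraMap ℝ (Forms n) r = α := by
  rw [ExteriorAlgebra.exteriorPower, pow_zero] at h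
  exact Submodule.mem_one.1 h

theorem interiorProd_mem {p : ℕ} (v : TSpace n) {α : Forms n}
    (h : α ∈ ⋀[ℝ]^(p + 1) (Module.Dual ℝ (TSpace n))) :
    interiorProd v α ∈ ⋀[ℝ]^p (Module.Dual ℝ (TSpace n)) := by
  induction p generalizing α with
  | zero =>
    refine exteriorPower_succ_induction
      (P := fun α => interiorProd v α ∈ ⋀[ℝ]^0 (Module.Dual ℝ (TSpace n)))
      (fun α β ha hb => ?_) (fun ξ α hα => ?_) h
    · rw [map_add]; exact add_mem ha hb
    · obtain ⟨r, rfl⟩ := exists_algebraMap_of_mem_zero hα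
      rw [interiorProd_ι_mul, interiorProd_algebraMap, mul_zero, sub_zero]
      exact Submodule.smul_mem _ _ hα
  | succ p ih =>
    refine exteriorPower_succ_induction
      (P := fun α => interiorProd v α ∈ ⋀[ℝ]^(p + 1) (Module.Dual ℝ (TSpace n)))
      (fun α β ha hb => ?_) (fun ξ α hα => ?_) h
    · rw [map_add]; exact add_mem ha hb
    · rw [interiorProd_ι_mul]
      exact sub_mem (Submodule.smul_mem _ _ hα) (ι_mul_mem ξ (ih hα))

/-- Euler's identity. It makes the degree operators scalars on homogeneous forms, and so lets a form
be recovered from its interior products. -/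
theorem sum_ι_mul_interiorProd {p : ℕ} {α : Forms n}
    (h : α ∈ ⋀[ℝ]^p (Module.Dual ℝ (TSpace n))) :
    ∑ i, ExteriorAlgebra.ι ℝ (b.coord i) * interiorProd (b i) α = (p : ℝ) • α := by
  induction p generalizing α with
  | zero =>
    obtain ⟨r, rfl⟩ := exists_algebraMap_of_mem_zero h
    simp [interiorProd_algebraMap]
  | succ p ih =>
    refine exteriorPower_succ_induction
      (P := fun α => ∑ i, ExteriorAlgebra.ι ℝ (b.coord i) * interiorProd (b i) α = ((p + 1 : ℕ) : ℝ) • α)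
      (fun α β ha hb => ?_) (fun ξ α hα => ?_) h
    · simp only [map_add, mul_add, Finset.sum_add_distrib, ha, hb, smul_add]
    · have key : ∀ i, ExteriorAlgebra.ι ℝ (b.coord i) *
          interiorProd (b i) (ExteriorAlgebra.ι ℝ ξ * α) =
          ExteriorAlgebra.ι ℝ (ξ (b i) • b.coord i) * α +
            ExteriorAlgebra.ι ℝ ξ * (ExteriorAlgebra.ι ℝ (b.coord i) * interiorProd (b i) α) := by
        intro i
        rw [interiorProd_ι_mul, mul_sub, ← mul_assoc _ (ExteriorAlgebra.ι ℝ ξ),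
          ι_mul_ι_comm (b.coord i) ξ, map_smul]
        simp [mul_assoc]
      have hξ : ∑ i, ξ (b i) • b.coord i = ξ := b.ext fun j => by
        simp
      rw [Finset.sum_congr rfl fun i _ => key i, Finset.sum_add_distrib, ← Finset.mul_sum, ih hα,
        ← Finset.sum_mul, ← map_sum, hξ]
      push_cast
      rw [mul_smul_comm, add_smul, one_smul, add_comm]

theorem tmul_mem_doubleForms {p : ℕ} {α β : Forms n}
    (hα : α ∈ ⋀[ℝ]^p (Module.Dual ℝ (TSpace n))) (hβ : β ∈ ⋀[ℝ]^p (Module.Dual ℝ (TSpace n))) :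
    α ⊗ₜ[ℝ] β ∈ doubleForms n p :=
  ⟨⟨α, hα⟩ ⊗ₜ ⟨β, hβ⟩, rfl⟩

theorem doubleForms_induction {p : ℕ} {P : DForms n → Prop}
    (hadd : ∀ α β, P α → P β → P (α + β))
    (htmul : ∀ α ∈ ⋀[ℝ]^p (Module.Dual ℝ (TSpace n)),
      ∀ β ∈ ⋀[ℝ]^p (Module.Dual ℝ (TSpace n)), P (α ⊗ₜ[ℝ] β)) {Ω : DForms n}
    (h : Ω ∈ doubleForms n p) : P Ω := by
  obtain ⟨t, rfl⟩ := h
  induction t using TensorProduct.induction_on with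
  | zero => simpa using htmul 0 (zero_mem _) 0 (zero_mem _)
  | tmul x y => exact htmul x x.2 y y.2
  | add x y hx hy => rw [map_add]; exact hadd _ _ hx hy

theorem basisMetric_mul_mem {p : ℕ} {Ω : DForms n} (h : Ω ∈ doubleForms n p) :
    basisMetric b * Ω ∈ doubleForms n (p + 1) := by
  refine doubleForms_induction
    (P := fun Ω => basisMetric b * Ω ∈ doubleForms n (p + 1))
    (fun α β ha hb => ?_) (fun α hα β hβ => ?_) h
  · rw [mul_add]; exact add_mem ha hb
  · rw [basisMetric, Finset.sum_mul]
    refine sum_mem fun i _ => ?_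
    rw [leftForm_mul_rightForm, Algebra.TensorProduct.tmul_mul_tmul]
    exact tmul_mem_doubleForms (ι_mul_mem _ hα) (ι_mul_mem _ hβ)

theorem one_mem_doubleForms : (1 : DForms n) ∈ doubleForms n 0 := by
  rw [Algebra.TensorProduct.one_def]
  exact tmul_mem_doubleForms (Submodule.one_le.1 le_rfl) (Submodule.one_le.1 le_rfl)

theorem basisMetric_pow_mem (p : ℕ) : basisMetric b ^ p ∈ doubleForms n p := by
  induction p with
  | zero => simpa using one_mem_doubleForms
  | succ p ih => rw [pow_succ']; exact basisMetric_mul_mem b ih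

theorem leftInterior_rightInterior_mem {p : ℕ} (v w : TSpace n) {Ω : DForms n}
    (h : Ω ∈ doubleForms n (p + 1)) :
    leftInterior v (rightInterior w Ω) ∈ doubleForms n p := by
  refine doubleForms_induction
    (P := fun Ω => leftInterior v (rightInterior w Ω) ∈ doubleForms n p)
    (fun α β ha hb => ?_) (fun α hα β hβ => ?_) h
  · rw [map_add, map_add]; exact add_mem ha hb
  · rw [← map_interiorProd]
    exact tmul_mem_doubleForms (interiorProd_mem v hα) (interiorProd_mem w hβ)

theorem leftDegree_of_mem {p : ℕ} {Ω : DForms n} (h : Ω ∈ doubleForms n p) :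
    leftDegree b Ω = (p : ℝ) • Ω := by
  refine doubleForms_induction
    (P := fun Ω => leftDegree b Ω = (p : ℝ) • Ω)
    (fun α β ha hb => ?_) (fun α hα β hβ => ?_) h
  · rw [smul_add, ← ha, ← hb]
    simp [leftDegree, mul_add, Finset.sum_add_distrib]
  · rw [TensorProduct.smul_tmul', ← sum_ι_mul_interiorProd b hα, TensorProduct.sum_tmul]
    simp [leftDegree, leftForm, leftInterior]

theorem rightDegree_of_mem {p : ℕ} {Ω : DForms n} (h : Ω ∈ doubleForms n p) :
    rightDegree b Ω = (p : ℝ) • Ω := by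
  refine doubleForms_induction
    (P := fun Ω => rightDegree b Ω = (p : ℝ) • Ω)
    (fun α β ha hb => ?_) (fun α hα β hβ => ?_) h
  · rw [smul_add, ← ha, ← hb]
    simp [rightDegree, mul_add, Finset.sum_add_distrib]
  · rw [← TensorProduct.tmul_smul, ← sum_ι_mul_interiorProd b hβ, TensorProduct.tmul_sum]
    simp [rightDegree, rightForm, rightInterior]

theorem eq_smul_one_of_mem_zero {Ω : DForms n} (h : Ω ∈ doubleForms n 0)
    (x y : Fin 0 → TSpace n) : Ω = evalDouble x y Ω • (1 : DForms n) := by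
  refine doubleForms_induction
    (P := fun Ω => Ω = evalDouble x y Ω • (1 : DForms n))
    (fun α β ha hb => ?_) (fun α hα β hβ => ?_) h
  · rw [map_add, add_smul, ← ha, ← hb]
  · obtain ⟨r, rfl⟩ := exists_algebraMap_of_mem_zero hα
    obtain ⟨s, rfl⟩ := exists_algebraMap_of_mem_zero hβ
    rw [evalDouble_tmul, evalForm_zero, evalForm_zero, AlgHom.commutes, AlgHom.commutes,
      Algebra.TensorProduct.one_def, Algebra.algebraMap_eq_smul_one,
      Algebra.algebraMap_eq_smul_one, TensorProduct.smul_tmul_smul]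
    rfl

/-- A double form of degree `p` vanishes if all its components do. -/
theorem eq_zero_of_evalDouble_eq_zero {p : ℕ} {Ω : DForms n} (h : Ω ∈ doubleForms n p)
    (h0 : ∀ I J : Fin p → Fin n, evalDouble (b ∘ I) (b ∘ J) Ω = 0) : Ω = 0 := by
  induction p generalizing Ω with
  | zero =>
    rw [eq_smul_one_of_mem_zero h (b ∘ Fin.elim0) (b ∘ Fin.elim0), h0, zero_smul]
  | succ p ih =>
    -- The components of this form are those of `Ω` with `i` and `j` put in front.
    have h1 : ∀ i j, leftInterior (b i) (rightInterior (b j) Ω) = 0 := by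
      intro i j
      refine ih (leftInterior_rightInterior_mem _ _ h) fun I J => ?_
      have := h0 (Fin.cons i I) (Fin.cons j J)
      rwa [evalDouble_succ] at this
    have hp : ((p + 1 : ℕ) : ℝ) ≠ 0 := by positivity
    -- Euler's identity in the second factor; it is then used once more in the first factor. The
    -- degree `p + 1` is invertible.
    have h2 : ∀ i, leftInterior (b i) Ω = 0 := by
      intro i
      have h3 := congrArg (leftInterior (b i)) (rightDegree_of_mem b h)
      rw [rightDegree, map_sum, map_smul] at h3
      simp only [leftInterior_rightForm_mul, h1, mul_zero, Finset.sum_const_zero] at h3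
      exact (smul_eq_zero.1 h3.symm).resolve_left hp
    have h4 := leftDegree_of_mem b h
    simp only [leftDegree, h2, mul_zero, Finset.sum_const_zero] at h4
    exact (smul_eq_zero.1 h4.symm).resolve_left hp

/-- A double form divisible by the metric, whose contraction is a multiple of a power of the
metric, is itself a multiple of a power of the metric. -/
theorem exists_eq_smul_basisMetric_pow {p : ℕ} (hp : p < n) {θ : DForms n}
    (hθ : θ ∈ doubleForms n p) {lam : ℝ}
    (h : basisContraction b (basisMetric b * θ) = lam • basisMetric b ^ p) :
    ∃ μ : ℝ, basisMetric b * θ = μ • basisMetric b ^ (p + 1) := by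
  have hc : ((p + 1) * (n - p) : ℝ) ≠ 0 := by
    have : (p : ℝ) < n := by exact_mod_cast hp
    exact mul_ne_zero (by positivity) (by linarith)
  -- The only candidate, since `c g^(p+1) = (p+1)(n-p) g^p`.
  refine ⟨lam / ((p + 1) * (n - p)), ?_⟩
  set μ := lam / ((p + 1) * (n - p) : ℝ) with hμ
  have e : basisMetric b * (θ - μ • basisMetric b ^ p) =
      basisMetric b * θ - μ • basisMetric b ^ (p + 1) := by
    rw [mul_sub, mul_smul_comm, pow_succ']
  have hmem : θ - μ • basisMetric b ^ p ∈ doubleForms n p :=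
    sub_mem hθ (Submodule.smul_mem _ _ (basisMetric_pow_mem b p))
  have h0 : basisContraction b (basisMetric b * (θ - μ • basisMetric b ^ p)) = 0 := by
    rw [e, map_sub, map_smul, h, basisContraction_pow_succ, smul_smul, hμ, div_mul_cancel₀ _ hc,
      sub_self]
  have := eq_zero_of_evalDouble_eq_zero b (basisMetric_mul_mem b hmem)
    (evalDouble_eq_zero_of_basisContraction_eq_zero b p _ h0)
  rw [e] at this
  exact sub_eq_zero.1 this

/-! ### Powers of the metric on orthonormal families -/

/-- In the antiderivation rule `ξ` is only ever evaluated on the `y i`, so it survives as a factor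
down to degree zero, where the augmentation kills it. -/
theorem evalDouble_rightForm_mul {p : ℕ} (x y : Fin p → TSpace n)
    (ξ : Module.Dual ℝ (TSpace n)) (hξ : ∀ i, ξ (y i) = 0) (Ω : DForms n) :
    evalDouble x y (rightForm ξ * Ω) = 0 := by
  induction p generalizing Ω with
  | zero =>
    induction Ω using TensorProduct.induction_on with
    | zero => simp
    | add x y hx hy => rw [mul_add, map_add, hx, hy, add_zero]
    | tmul α β =>
      simp [rightForm, evalDouble_tmul, evalForm_zero, ExteriorAlgebra.algebraMapInv]
  | succ p ih =>
    rw [evalDouble_succ, rightInterior_rightForm_mul, hξ 0, zero_smul, zero_sub, map_neg,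
      leftInterior_rightForm_mul, map_neg, ih _ (Fin.tail y) (fun i => hξ i.succ), neg_zero]

/-- Inserting `x 0` in the first factor of `g^(p+1)` gives `p + 1` times its dual covector times
`g^p`. Inserting `x 0` in the second factor turns that covector into `1`; the other term keeps it as
a factor and vanishes, because it annihilates the remaining `x i`. -/
theorem evalDouble_basisMetric_pow {p : ℕ} (x : Fin p → TSpace n)
    (hx : ∀ i j, flat b (x i) (x j) = if i = j then 1 else 0) :
    evalDouble x x (basisMetric b ^ p) = (p.factorial : ℝ) := by
  induction p with
  | zero =>
    rw [pow_zero, Algebra.TensorProduct.one_def, evalDouble_tmul]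
    simp [evalForm_zero]
  | succ p ih =>
    rw [evalDouble_succ, ← rightInterior_leftInterior, leftInterior_pow, map_smul,
      rightInterior_rightForm_mul, map_smul, map_sub,
      evalDouble_rightForm_mul _ _ _ (fun i => by
        rw [Fin.tail, hx]; exact if_neg (Fin.succ_ne_zero i).symm),
      hx, if_pos rfl, one_smul, ih, sub_zero, Nat.factorial_succ]
    · simp
    · intro i j
      simp [Fin.tail, hx]

end Evaluation

/-! ## Levi-Civita connections of metrics on a normed space -/

section Connection

variable {E : Type*} [NormedAddCommGroup E] [NormedSpace ℝ E]
  {E' : Type*} [NormedAddCommGroup E'] [NormedSpace ℝ E']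

open Filter Topology

/-- `Γ` is the Levi-Civita connection of `B` at `y`. -/
structure IsLeviCivitaAt (B : E → E →L[ℝ] E →L[ℝ] ℝ) (Γ : E → E →L[ℝ] E →L[ℝ] E) (y : E) :
    Prop where
  symm : ∀ u v, Γ y u v = Γ y v u
  compat : ∀ u v w, fderiv ℝ B y u v w = B y (Γ y u v) w + B y v (Γ y u w)

/-- The curvature operator of the connection `Γ`. -/
def curvatureOperator (Γ : E → E →L[ℝ] E →L[ℝ] E) (y : E) (u v w : E) : E :=
  fderiv ℝ Γ y u v w - fderiv ℝ Γ y v u w + Γ y u (Γ y v w) - Γ y v (Γ y u w)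

/-- The argument behind uniqueness of the Levi-Civita connection: alternating the two symmetries six
times returns to the start with the opposite sign. -/
theorem eq_zero_of_symm_of_antisymm {V : Type*} {S : V → V → V → ℝ} (h1 : ∀ u v w, S u v w = S v u w)
    (h2 : ∀ u v w, S u v w + S u w v = 0) (u v w : V) : S u v w = 0 := by
  have a1 := h2 u v w
  have a2 := h1 u w v
  have a3 := h2 w u v
  have a4 := h1 w v u
  have a5 := h2 v w u
  have a6 := h1 v u w
  linarith

/-- The transformation law of the Levi-Civita connection. -/
theorem IsLeviCivitaAt.transform {B : E → E →L[ℝ] E →L[ℝ] ℝ} {Γ : E → E →L[ℝ] E →L[ℝ] E}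
    {B' : E' → E' →L[ℝ] E' →L[ℝ] ℝ} {Γ' : E' → E' →L[ℝ] E' →L[ℝ] E'} {Φ : E → E'} {y : E}
    (hΦ : ContDiffAt ℝ 2 Φ y) (hB : DifferentiableAt ℝ B y) (hB' : DifferentiableAt ℝ B' (Φ y))
    (hpull : ∀ᶠ z in 𝓝 y, ∀ u v, B z u v = B' (Φ z) (fderiv ℝ Φ z u) (fderiv ℝ Φ z v))
    (hsymm : ∀ u v, B' (Φ y) u v = B' (Φ y) v u)
    (hnondeg : ∀ u, (∀ v, B' (Φ y) u v = 0) → u = 0)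
    (hsurj : Function.Surjective (fderiv ℝ Φ y))
    (hΓ : IsLeviCivitaAt B Γ y) (hΓ' : IsLeviCivitaAt B' Γ' (Φ y)) (u v : E) :
    fderiv ℝ Φ y (Γ y u v) =
      Γ' (Φ y) (fderiv ℝ Φ y u) (fderiv ℝ Φ y v) + fderiv ℝ (fderiv ℝ Φ) y u v := by
  have hsnd : ∀ u v, fderiv ℝ (fderiv ℝ Φ) y u v = fderiv ℝ (fderiv ℝ Φ) y v u :=
    hΦ.isSymmSndFDerivAt (by simp)
  have hD : HasFDerivAt (fderiv ℝ Φ) (fderiv ℝ (fderiv ℝ Φ) y) y :=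
    ((hΦ.fderiv_right (m := 1) le_rfl).differentiableAt one_ne_zero).hasFDerivAt
  have hΦd : HasFDerivAt Φ (fderiv ℝ Φ y) y := (hΦ.differentiableAt two_ne_zero).hasFDerivAt
  -- Differentiate the pullback relation between the metrics; the second derivatives of `Φ` come
  -- from the two arguments.
  have hderiv : ∀ u v w, fderiv ℝ B y u v w =
      fderiv ℝ B' (Φ y) (fderiv ℝ Φ y u) (fderiv ℝ Φ y v) (fderiv ℝ Φ y w)
      + B' (Φ y) (fderiv ℝ (fderiv ℝ Φ) y u v) (fderiv ℝ Φ y w)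
      + B' (Φ y) (fderiv ℝ Φ y v) (fderiv ℝ (fderiv ℝ Φ) y u w) := by
    intro u v w
    have h1 := (hB.hasFDerivAt.clm_apply (hasFDerivAt_const v y)).clm_apply (hasFDerivAt_const w y)
    have hc : HasFDerivAt (fun z => B' (Φ z)) ((fderiv ℝ B' (Φ y)).comp (fderiv ℝ Φ y)) y :=
      HasFDerivAt.comp (G := E' →L[ℝ] E' →L[ℝ] ℝ) y hB'.hasFDerivAt hΦd
    have h2 := (hc.clm_apply
      (hD.clm_apply (hasFDerivAt_const v y))).clm_apply (hD.clm_apply (hasFDerivAt_const w y))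
    have h3 : (fun z => B z v w) =ᶠ[𝓝 y]
        fun z => B' (Φ z) (fderiv ℝ Φ z v) (fderiv ℝ Φ z w) := hpull.mono fun z hz => hz v w
    have h4 := congrArg (fun L => L u) (h1.unique (h2.congr_of_eventuallyEq h3))
    simp at h4
    rw [h4]
    ring
  have hpull' := hpull.self_of_nhds
  -- The defect of the transformation law, lowered by the metric, is symmetric in `u, v` (both
  -- connections are torsion free) and antisymmetric in `v, w` (both are metric).
  have key := eq_zero_of_symm_of_antisymm
    (S := fun u v w => B' (Φ y) (fderiv ℝ Φ y (Γ y u v) -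
      (Γ' (Φ y) (fderiv ℝ Φ y u) (fderiv ℝ Φ y v) + fderiv ℝ (fderiv ℝ Φ) y u v))
      (fderiv ℝ Φ y w))
    (fun u v w => by
      rw [hΓ.symm u v, hΓ'.symm (fderiv ℝ Φ y u), hsnd u v])
    (fun u v w => by
      have h1 := hderiv u v w
      rw [hΓ.compat, hΓ'.compat, hpull', hpull'] at h1
      simp only [map_sub, map_add, sub_apply, add_apply]
      rw [hsymm _ (fderiv ℝ Φ y v), hsymm _ (fderiv ℝ Φ y v), hsymm _ (fderiv ℝ Φ y v)]
      linarith)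
  refine sub_eq_zero.1 (hnondeg _ fun w' => ?_)
  obtain ⟨w, rfl⟩ := hsurj w'
  exact key u v w

/-- The transformation law of the curvature operator. -/
theorem curvatureOperator_transform {Γ : E → E →L[ℝ] E →L[ℝ] E}
    {Γ' : E' → E' →L[ℝ] E' →L[ℝ] E'} {Φ : E → E'} {y : E}
    (hΦ : ContDiffAt ℝ 3 Φ y) (hΓ : DifferentiableAt ℝ Γ y)
    (hΓ' : DifferentiableAt ℝ Γ' (Φ y))
    (h : ∀ᶠ z in 𝓝 y, ∀ u v, fderiv ℝ Φ z (Γ z u v) =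
      Γ' (Φ z) (fderiv ℝ Φ z u) (fderiv ℝ Φ z v) + fderiv ℝ (fderiv ℝ Φ) z u v) (u v w : E) :
    fderiv ℝ Φ y (curvatureOperator Γ y u v w) =
      curvatureOperator Γ' (Φ y) (fderiv ℝ Φ y u) (fderiv ℝ Φ y v) (fderiv ℝ Φ y w) := by
  have hΦ1 : ContDiffAt ℝ 2 (fderiv ℝ Φ) y := hΦ.fderiv_right (m := 2) (by norm_num)
  have hΦ2 : ContDiffAt ℝ 1 (fderiv ℝ (fderiv ℝ Φ)) y := hΦ1.fderiv_right (m := 1) (by norm_num)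
  have hsnd : ∀ u v, fderiv ℝ (fderiv ℝ Φ) y u v = fderiv ℝ (fderiv ℝ Φ) y v u :=
    (hΦ.of_le (by norm_num : (2 : WithTop ℕ∞) ≤ 3)).isSymmSndFDerivAt (by simp)
  have htrd : ∀ u v w, fderiv ℝ (fderiv ℝ (fderiv ℝ Φ)) y u v w =
      fderiv ℝ (fderiv ℝ (fderiv ℝ Φ)) y v u w := fun u v w => by
    rw [hΦ1.isSymmSndFDerivAt (by simp)]
  have hD0 : HasFDerivAt Φ (fderiv ℝ Φ y) y := (hΦ.differentiableAt three_ne_zero).hasFDerivAt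
  have hD1 : HasFDerivAt (fderiv ℝ Φ) (fderiv ℝ (fderiv ℝ Φ) y) y :=
    (hΦ1.differentiableAt two_ne_zero).hasFDerivAt
  have hD2 : HasFDerivAt (fderiv ℝ (fderiv ℝ Φ)) (fderiv ℝ (fderiv ℝ (fderiv ℝ Φ)) y) y :=
    (hΦ2.differentiableAt one_ne_zero).hasFDerivAt
  -- The derivative of the transformation law in the direction `u`.
  have hd : ∀ u v w, fderiv ℝ (fderiv ℝ Φ) y u (Γ y v w) + fderiv ℝ Φ y (fderiv ℝ Γ y u v w) =
      fderiv ℝ Γ' (Φ y) (fderiv ℝ Φ y u) (fderiv ℝ Φ y v) (fderiv ℝ Φ y w)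
      + Γ' (Φ y) (fderiv ℝ (fderiv ℝ Φ) y u v) (fderiv ℝ Φ y w)
      + Γ' (Φ y) (fderiv ℝ Φ y v) (fderiv ℝ (fderiv ℝ Φ) y u w)
      + fderiv ℝ (fderiv ℝ (fderiv ℝ Φ)) y u v w := by
    intro u v w
    have h1 := hD1.clm_apply ((hΓ.hasFDerivAt.clm_apply (hasFDerivAt_const v y)).clm_apply
      (hasFDerivAt_const w y))
    have h2 := (((hΓ'.hasFDerivAt.comp y hD0).clm_apply
      (hD1.clm_apply (hasFDerivAt_const v y))).clm_apply
        (hD1.clm_apply (hasFDerivAt_const w y))).add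
      ((hD2.clm_apply (hasFDerivAt_const v y)).clm_apply (hasFDerivAt_const w y))
    have h3 := h.mono fun z hz => hz v w
    have h4 := congrArg (fun L => L u) (h1.unique (h2.congr_of_eventuallyEq h3))
    simp at h4
    rw [add_comm, h4]
    abel
  have h0 := h.self_of_nhds
  have hd' : ∀ u v w, fderiv ℝ Φ y (fderiv ℝ Γ y u v w) =
      fderiv ℝ Γ' (Φ y) (fderiv ℝ Φ y u) (fderiv ℝ Φ y v) (fderiv ℝ Φ y w)
      + Γ' (Φ y) (fderiv ℝ (fderiv ℝ Φ) y u v) (fderiv ℝ Φ y w)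
      + Γ' (Φ y) (fderiv ℝ Φ y v) (fderiv ℝ (fderiv ℝ Φ) y u w)
      + fderiv ℝ (fderiv ℝ (fderiv ℝ Φ)) y u v w - fderiv ℝ (fderiv ℝ Φ) y u (Γ y v w) :=
    fun u v w => eq_sub_of_add_eq' (hd u v w)
  simp only [curvatureOperator, map_add, map_sub, hd']
  -- After antisymmetrizing in `u, v` the third derivatives of `Φ` cancel by symmetry, and the
  -- second derivatives cancel against those produced by the terms quadratic in the connection.
  rw [h0 u (Γ y v w), h0 v (Γ y u w), h0 v w, h0 u w, map_add, map_add, hsnd v u, htrd v u]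
  abel

end Connection

/-! ## Metrics in coordinates -/

section Coordinates

open Filter Topology

variable {n : ℕ}

/-- The `i`-th coordinate, as a continuous linear form. -/
abbrev coordCLM (i : Fin n) : TSpace n →L[ℝ] ℝ := EuclideanSpace.proj i

theorem stdBasis_apply (i j : Fin n) : (stdBasis n i : TSpace n) j = if j = i then 1 else 0 := by
  simp

theorem sum_apply_smul_stdBasis (u : TSpace n) : ∑ i, u i • (stdBasis n i : TSpace n) = u := by
  conv_rhs => rw [← (stdBasis n).sum_repr u]
  rfl

theorem IsLinearMap.eq_sum {f : TSpace n → ℝ} (hf : IsLinearMap ℝ f) (u : TSpace n) :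
    f u = ∑ i, u i * f (stdBasis n i) := by
  conv_lhs => rw [← sum_apply_smul_stdBasis u, ← IsLinearMap.mk'_apply hf, map_sum]
  simp

theorem stdBasis_induction {P : TSpace n → Prop} (h0 : P 0) (h : ∀ i, P (stdBasis n i))
    (hadd : ∀ u v, P u → P v → P (u + v)) (hsmul : ∀ (r : ℝ) u, P u → P (r • u))
    (u : TSpace n) : P u := by
  refine Submodule.span_induction (p := fun u _ => P u) ?_ h0 (fun u v _ _ => hadd u v)
    (fun r u _ => hsmul r u) ((stdBasis n).mem_span u)
  rintro _ ⟨i, rfl⟩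
  exact h i

/-- The bilinear form with Gram matrix `G y`. -/
def metricBilin (G : TSpace n → Matrix (Fin n) (Fin n) ℝ) (y : TSpace n) :
    TSpace n →L[ℝ] TSpace n →L[ℝ] ℝ :=
  ∑ i, ∑ j, G y i j • (coordCLM i).smulRight (coordCLM j)

theorem metricBilin_apply (G : TSpace n → Matrix (Fin n) (Fin n) ℝ) (y u v : TSpace n) :
    metricBilin G y u v = ∑ i, ∑ j, G y i j * (u i * v j) := by
  simp [metricBilin]

theorem metricBilin_stdBasis (G : TSpace n → Matrix (Fin n) (Fin n) ℝ) (y : TSpace n)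
    (i j : Fin n) : metricBilin G y (stdBasis n i) (stdBasis n j) = G y i j := by
  simp [metricBilin_apply]

theorem metricBilin_stdBasis_left (G : TSpace n → Matrix (Fin n) (Fin n) ℝ) (y v : TSpace n)
    (i : Fin n) : metricBilin G y (stdBasis n i) v = ∑ j, G y i j * v j := by
  rw [metricBilin_apply, Finset.sum_eq_single i]
  · simp
  · intro a _ ha
    simp [ha]
  · simp

/-- The Levi-Civita connection in coordinates. -/
def christoffelBilin (G : TSpace n → Matrix (Fin n) (Fin n) ℝ) (y : TSpace n) :
    TSpace n →L[ℝ] TSpace n →L[ℝ] TSpace n :=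
  ∑ k, ∑ i, ∑ j, christoffel G k i j y •
    (coordCLM i).smulRight ((coordCLM j).smulRight (stdBasis n k : TSpace n))

theorem christoffelBilin_apply (G : TSpace n → Matrix (Fin n) (Fin n) ℝ) (y u v : TSpace n)
    (k : Fin n) :
    christoffelBilin G y u v k = ∑ i, ∑ j, christoffel G k i j y * (u i * v j) := by
  simp only [christoffelBilin, sum_apply, smul_apply, ContinuousLinearMap.smulRight_apply,
    WithLp.ofLp_sum, WithLp.ofLp_smul, Finset.sum_apply, Pi.smul_apply, smul_eq_mul]
  rw [Finset.sum_eq_single k]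
  · simp
  · intro a _ ha
    simp [ha.symm]
  · simp

theorem christoffelBilin_stdBasis (G : TSpace n → Matrix (Fin n) (Fin n) ℝ) (y : TSpace n)
    (k i j : Fin n) :
    christoffelBilin G y (stdBasis n i) (stdBasis n j) k = christoffel G k i j y := by
  simp [christoffelBilin_apply]

theorem christoffelBilin_stdBasis_left (G : TSpace n → Matrix (Fin n) (Fin n) ℝ)
    (y v : TSpace n) (k i : Fin n) :
    christoffelBilin G y (stdBasis n i) v k = ∑ j, christoffel G k i j y * v j := by
  rw [christoffelBilin_apply, Finset.sum_eq_single i]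
  · simp
  · intro a _ ha
    simp [ha]
  · simp

/-- `G` is the Gram matrix of a metric, smooth at `y`. -/
structure IsSmoothMetricAt (G : TSpace n → Matrix (Fin n) (Fin n) ℝ) (y : TSpace n) : Prop where
  smooth : ∀ i j, ContDiffAt ℝ ∞ (fun z => G z i j) y
  posDef : (G y).PosDef

variable {G : TSpace n → Matrix (Fin n) (Fin n) ℝ} {y : TSpace n}

theorem contDiffAt_det {A : TSpace n → Matrix (Fin n) (Fin n) ℝ}
    (h : ∀ i j, ContDiffAt ℝ ∞ (fun z => A z i j) y) :
    ContDiffAt ℝ ∞ (fun z => (A z).det) y := by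
  simp only [Matrix.det_apply']
  exact ContDiffAt.sum fun σ _ => contDiffAt_const.mul (contDiffAt_prod fun i _ => h _ _)

theorem IsSmoothMetricAt.symm (h : IsSmoothMetricAt G y) (i j : Fin n) : G y i j = G y j i := by
  simpa using h.posDef.isHermitian.apply j i

theorem IsSmoothMetricAt.det_ne_zero (h : IsSmoothMetricAt G y) : (G y).det ≠ 0 :=
  h.posDef.det_pos.ne'

theorem IsSmoothMetricAt.contDiffAt_inv (h : IsSmoothMetricAt G y) (i j : Fin n) :
    ContDiffAt ℝ ∞ (fun z => (G z)⁻¹ i j) y := by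
  -- Cramer's rule exhibits the entries of the inverse as quotients of determinants.
  have e : ∀ z, (G z)⁻¹ i j = ((G z).det)⁻¹ * ((G z).updateRow j (Pi.single i 1)).det := by
    intro z
    rw [Matrix.inv_def, Matrix.smul_apply, Ring.inverse_eq_inv', Matrix.adjugate_apply,
      smul_eq_mul]
  simp only [e]
  refine ((contDiffAt_det h.smooth).inv h.det_ne_zero).mul (contDiffAt_det fun k l => ?_)
  simp only [Matrix.updateRow_apply]
  split_ifs
  · exact contDiffAt_const
  · exact h.smooth k l

theorem contDiffAt_partialDeriv {f : TSpace n → ℝ} (h : ContDiffAt ℝ ∞ f y) (i : Fin n) :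
    ContDiffAt ℝ ∞ (partialDeriv i f) y :=
  (h.fderiv_right (m := ∞) (by simp)).clm_apply contDiffAt_const

theorem IsSmoothMetricAt.contDiffAt_christoffel (h : IsSmoothMetricAt G y) (k i j : Fin n) :
    ContDiffAt ℝ ∞ (christoffel G k i j) y :=
  contDiffAt_const.mul (ContDiffAt.sum fun l _ => (h.contDiffAt_inv k l).mul
    (((contDiffAt_partialDeriv (h.smooth _ _) _).add
      (contDiffAt_partialDeriv (h.smooth _ _) _)).sub
        (contDiffAt_partialDeriv (h.smooth _ _) _)))

theorem contDiffAt_smul_const {E F : Type*} [NormedAddCommGroup E] [NormedSpace ℝ E]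
    [NormedAddCommGroup F] [NormedSpace ℝ F] {f : E → ℝ} {y : E} (hf : ContDiffAt ℝ ∞ f y)
    (c : F) : ContDiffAt ℝ ∞ (fun z => f z • c) y :=
  hf.smul contDiffAt_const

theorem IsSmoothMetricAt.contDiffAt_metricBilin (h : IsSmoothMetricAt G y) :
    ContDiffAt ℝ ∞ (metricBilin G) y :=
  ContDiffAt.sum fun i _ => ContDiffAt.sum fun j _ => 
    contDiffAt_smul_const (h.smooth i j) _

theorem IsSmoothMetricAt.contDiffAt_christoffelBilin (h : IsSmoothMetricAt G y) :
    ContDiffAt ℝ ∞ (christoffelBilin G) y :=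
  ContDiffAt.sum fun k _ => ContDiffAt.sum fun i _ => ContDiffAt.sum fun j _ =>
    contDiffAt_smul_const (h.contDiffAt_christoffel k i j) _

theorem IsSmoothMetricAt.metricBilin_symm (h : IsSmoothMetricAt G y) (u v : TSpace n) :
    metricBilin G y u v = metricBilin G y v u := by
  rw [metricBilin_apply, metricBilin_apply, Finset.sum_comm]
  refine Finset.sum_congr rfl fun i _ => Finset.sum_congr rfl fun j _ => ?_
  rw [h.symm, mul_comm (u j)]

theorem IsSmoothMetricAt.metricBilin_nondeg (h : IsSmoothMetricAt G y) (u : TSpace n)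
    (hu : ∀ v, metricBilin G y u v = 0) : u = 0 := by
  have h1 := Matrix.eq_zero_of_vecMul_eq_zero (v := fun i => u i) h.det_ne_zero (by
    ext j
    have := hu (stdBasis n j)
    simp only [metricBilin_apply, stdBasis_apply, mul_ite, mul_one, mul_zero,
      Finset.sum_ite_eq', Finset.mem_univ, if_true] at this
    rw [Matrix.vecMul, dotProduct, Pi.zero_apply, ← this]
    exact Finset.sum_congr rfl fun i _ => mul_comm _ _)
  ext i
  exact congrFun h1 i

theorem sum_mul_christoffel (h : (G y).det ≠ 0) (k i j : Fin n) :
    ∑ l, G y k l * christoffel G l i j y = (1 / 2 : ℝ) *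
      (partialDeriv i (fun z => G z j k) y + partialDeriv j (fun z => G z i k) y
        - partialDeriv k (fun z => G z i j) y) := by
  set f : Fin n → ℝ := fun l => partialDeriv i (fun z => G z j l) y +
    partialDeriv j (fun z => G z i l) y - partialDeriv l (fun z => G z i j) y with hf
  have h1 : ∀ l, christoffel G l i j y = (1 / 2 : ℝ) * ((G y)⁻¹.mulVec f) l := fun l => rfl
  have h2 : (G y).mulVec ((G y)⁻¹.mulVec f) k = f k := by
    rw [Matrix.mulVec_mulVec, Matrix.mul_nonsing_inv _ (isUnit_iff_ne_zero.2 h),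
      Matrix.one_mulVec]
  change _ = (1 / 2 : ℝ) * f k
  rw [← h2, Matrix.mulVec, dotProduct, Finset.mul_sum]
  refine Finset.sum_congr rfl fun l _ => ?_
  rw [h1]
  ring

theorem hasFDerivAt_clm_apply₂ {E F H K : Type*} [NormedAddCommGroup E] [NormedSpace ℝ E]
    [NormedAddCommGroup F] [NormedSpace ℝ F] [NormedAddCommGroup H] [NormedSpace ℝ H]
    [NormedAddCommGroup K] [NormedSpace ℝ K]
    {f : E → F →L[ℝ] H →L[ℝ] K} {y : E} (hf : DifferentiableAt ℝ f y) (v : F) (w : H) (u : E) :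
    fderiv ℝ (fun z => f z v w) y u = fderiv ℝ f y u v w := by
  have h := (hf.hasFDerivAt.clm_apply (hasFDerivAt_const v y)).clm_apply (hasFDerivAt_const w y)
  rw [h.fderiv]
  simp

theorem isLeviCivitaAt_christoffelBilin (hG : ∀ᶠ z in 𝓝 y, IsSmoothMetricAt G z) :
    IsLeviCivitaAt (metricBilin G) (christoffelBilin G) y := by
  have h := hG.self_of_nhds
  -- Differentiating the symmetry of `G` requires it on a neighbourhood, not only at `y`.
  have hsymm : ∀ i j l, partialDeriv l (fun z => G z i j) y = partialDeriv l (fun z => G z j i) y :=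
    fun i j l => by
      have e : (fun z => G z i j) =ᶠ[𝓝 y] fun z => G z j i := hG.mono fun z hz => hz.symm i j
      rw [partialDeriv, partialDeriv, e.fderiv_eq]
  -- The Koszul formula on coordinate vectors; metric compatibility is the sum of two instances.
  have hlower : ∀ i j k, metricBilin G y (christoffelBilin G y (stdBasis n i) (stdBasis n j))
      (stdBasis n k) = (1 / 2 : ℝ) *
      (partialDeriv i (fun z => G z j k) y + partialDeriv j (fun z => G z i k) y
        - partialDeriv k (fun z => G z i j) y) := by
    intro i j k
    rw [← sum_mul_christoffel h.det_ne_zero, h.metricBilin_symm, metricBilin_stdBasis_left]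
    simp only [christoffelBilin_stdBasis]
  refine ⟨fun u v => ?_, fun u v w => ?_⟩
  · ext k
    rw [christoffelBilin_apply, christoffelBilin_apply, Finset.sum_comm]
    refine Finset.sum_congr rfl fun i _ => Finset.sum_congr rfl fun j _ => ?_
    rw [mul_comm (u j)]
    congr 1
    rw [christoffel, christoffel]
    congr 1
    refine Finset.sum_congr rfl fun l _ => ?_
    rw [hsymm j i, add_comm (partialDeriv j _ y)]
  · induction u using stdBasis_induction with
    | h0 => simp
    | hadd a b ha hb => simp only [map_add, add_apply, ha, hb]; ring
    | hsmul r a ha => simp only [map_smul, smul_apply, smul_eq_mul, ha]; ring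
    | h i =>
    induction v using stdBasis_induction with
    | h0 => simp
    | hadd a b ha hb => simp only [map_add, add_apply, ha, hb]; ring
    | hsmul r a ha => simp only [map_smul, smul_apply, smul_eq_mul, ha]; ring
    | h j =>
    induction w using stdBasis_induction with
    | h0 => simp
    | hadd a b ha hb => simp only [map_add, ha, hb]; ring
    | hsmul r a ha => simp only [map_smul, smul_eq_mul, ha]; ring
    | h k =>
    have h1 := hasFDerivAt_clm_apply₂ (h.contDiffAt_metricBilin.differentiableAt (by simp))
      (stdBasis n j) (stdBasis n k) (stdBasis n i)
    simp only [metricBilin_stdBasis] at h1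
    rw [← h1, h.metricBilin_symm (stdBasis n j), hlower, hlower, hsymm k j i]
    simp only [partialDeriv]
    ring

/-- The covariant curvature tensor in coordinates. -/
def curvatureTensor (G : TSpace n → Matrix (Fin n) (Fin n) ℝ) (y u v w x : TSpace n) : ℝ :=
  metricBilin G y w (curvatureOperator (christoffelBilin G) y u v x)

/-- Links the index formula to the coordinate-free curvature operator, for which the transformation
law is proved. -/
theorem curvatureComponents_eq (h : IsSmoothMetricAt G y) (i j k l : Fin n) :
    curvatureComponents G y i j k l =
      curvatureTensor G y (stdBasis n i) (stdBasis n j) (stdBasis n k) (stdBasis n l) := by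
  have hd := h.contDiffAt_christoffelBilin.differentiableAt (by simp)
  have h1 : ∀ i j k l, fderiv ℝ (christoffelBilin G) y (stdBasis n i) (stdBasis n j)
      (stdBasis n k) l = partialDeriv i (christoffel G l j k) y := by
    intro i j k l
    rw [← hasFDerivAt_clm_apply₂ hd, partialDeriv]
    have h2 : DifferentiableAt ℝ
        (fun z => christoffelBilin G z (stdBasis n j) (stdBasis n k)) y :=
      (hd.clm_apply (differentiableAt_const _)).clm_apply (differentiableAt_const _)
    have h3 := (coordCLM l).hasFDerivAt.comp y h2.hasFDerivAt
    have h4 : (coordCLM l ∘ fun z => christoffelBilin G z (stdBasis n j) (stdBasis n k)) =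
        christoffel G l j k := by
      ext z
      exact christoffelBilin_stdBasis G z l j k
    rw [h4] at h3
    rw [h3.fderiv]
    rfl
  have h5 : ∀ i j k l, christoffelBilin G y (stdBasis n i)
      (christoffelBilin G y (stdBasis n j) (stdBasis n k)) l =
      ∑ m, christoffel G l i m y * christoffel G m j k y := by
    intro i j k l
    rw [christoffelBilin_stdBasis_left]
    simp only [christoffelBilin_stdBasis]
  rw [curvatureTensor, metricBilin_stdBasis_left, curvatureComponents]
  refine Finset.sum_congr rfl fun m _ => ?_
  simp only [curvatureOperator, curvatureCoeff, PiLp.add_apply, PiLp.sub_apply, h1, h5,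
    Finset.sum_sub_distrib]
  ring

end Coordinates

/-! ## Pullback of double forms and naturality of the curvature -/

section Pullback

open Filter Topology

variable {n : ℕ}

/-- The pullback of exterior forms by a linear map. -/
def pullbackForms (A : TSpace n →ₗ[ℝ] TSpace n) : Forms n →ₐ[ℝ] Forms n :=
  ExteriorAlgebra.map A.dualMap

/-- The pullback of double forms by a linear map. -/
def pullbackDouble (A : TSpace n →ₗ[ℝ] TSpace n) : DForms n →ₐ[ℝ] DForms n :=
  Algebra.TensorProduct.map (pullbackForms A) (pullbackForms A)

theorem pullbackForms_dx (A : TSpace n →ₗ[ℝ] TSpace n) (a : Fin n) :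
    pullbackForms A (dx a) = ∑ i, A (stdBasis n i) a • dx i := by
  have h : A.dualMap ((stdBasis n).coord a) =
      ∑ i, A (stdBasis n i) a • (stdBasis n).coord i := by
    refine (stdBasis n).ext fun j => ?_
    rw [LinearMap.dualMap_apply, LinearMap.sum_apply, Finset.sum_eq_single j]
    · simp only [LinearMap.smul_apply, Module.Basis.coord_apply, Module.Basis.repr_self,
        Finsupp.single_eq_same, smul_eq_mul, mul_one]
      rfl
    · intro i _ hi
      simp only [LinearMap.smul_apply, Module.Basis.coord_apply, Module.Basis.repr_self,
        Finsupp.single_eq_of_ne hi, smul_zero]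
    · simp
  rw [pullbackForms, dx, ExteriorAlgebra.map_apply_ι, h, map_sum]
  simp [dx]

theorem pullbackDouble_ofComponents₁ (A : TSpace n →ₗ[ℝ] TSpace n) {B B' : Fin n → Fin n → ℝ}
    (h : ∀ i j, B i j = ∑ a, A (stdBasis n i) a * ∑ b, A (stdBasis n j) b * B' a b) :
    pullbackDouble A (ofComponents₁ B') = ofComponents₁ B := by
  have hL : pullbackDouble A (ofComponents₁ B') = ∑ p : Fin n × Fin n, ∑ q : Fin n × Fin n,
      (A (stdBasis n q.1) p.1 * (A (stdBasis n q.2) p.2 * B' p.1 p.2)) •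
        (dx q.1 ⊗ₜ[ℝ] dx q.2 : DForms n) := by
    simp only [ofComponents₁, map_sum, map_smul, pullbackDouble, Algebra.TensorProduct.map_tmul,
      pullbackForms_dx, TensorProduct.sum_tmul, Fintype.sum_prod_type]
    simp only [TensorProduct.tmul_sum, TensorProduct.smul_tmul_smul, Finset.smul_sum, smul_smul]
    refine Finset.sum_congr rfl fun a _ => Finset.sum_congr rfl fun b _ =>
      Finset.sum_congr rfl fun i _ => Finset.sum_congr rfl fun j _ => ?_
    congr 1
    ring
  rw [hL, Finset.sum_comm, ofComponents₁]
  simp only [Fintype.sum_prod_type, h, Finset.mul_sum, Finset.sum_smul]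

/-- The nested sums in the hypothesis are what expanding a multilinear function one argument at a
time produces. -/
theorem pullbackDouble_ofComponents₂ (A : TSpace n →ₗ[ℝ] TSpace n)
    {F F' : Fin n → Fin n → Fin n → Fin n → ℝ}
    (h : ∀ i j k l, F i j k l = ∑ a, A (stdBasis n i) a * ∑ b, A (stdBasis n j) b *
      ∑ c, A (stdBasis n k) c * ∑ d, A (stdBasis n l) d * F' a b c d) :
    pullbackDouble A (ofComponents₂ F') = ofComponents₂ F := by
  have hL : ∑ a, ∑ b, ∑ c, ∑ d, F' a b c d • pullbackDouble A
        ((dx a * dx b) ⊗ₜ[ℝ] (dx c * dx d)) =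
      ∑ p : Fin n × Fin n × Fin n × Fin n, ∑ q : Fin n × Fin n × Fin n × Fin n,
      (A (stdBasis n q.1) p.1 * (A (stdBasis n q.2.1) p.2.1 * (A (stdBasis n q.2.2.1) p.2.2.1 *
        (A (stdBasis n q.2.2.2) p.2.2.2 * F' p.1 p.2.1 p.2.2.1 p.2.2.2)))) •
        ((dx q.1 * dx q.2.1) ⊗ₜ[ℝ] (dx q.2.2.1 * dx q.2.2.2) : DForms n) := by
    simp only [Fintype.sum_prod_type]
    refine Finset.sum_congr rfl fun a _ => Finset.sum_congr rfl fun b _ =>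
      Finset.sum_congr rfl fun c _ => Finset.sum_congr rfl fun d _ => ?_
    simp only [pullbackDouble, Algebra.TensorProduct.map_tmul, map_mul, pullbackForms_dx,
      Finset.sum_mul_sum, TensorProduct.sum_tmul]
    simp only [TensorProduct.tmul_sum, smul_mul_smul_comm, TensorProduct.smul_tmul_smul, Finset.smul_sum, smul_smul]
    refine Finset.sum_congr rfl fun i _ => Finset.sum_congr rfl fun j _ =>
      Finset.sum_congr rfl fun k _ => Finset.sum_congr rfl fun l _ => ?_
    congr 1
    ring
  simp only [ofComponents₂, map_smul, map_sum]
  rw [hL, Finset.sum_comm]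
  simp only [Fintype.sum_prod_type, h, Finset.mul_sum, Finset.sum_smul]

variable {G G' : TSpace n → Matrix (Fin n) (Fin n) ℝ} {Φ : TSpace n → TSpace n} {y : TSpace n}

/-- `Φ` pulls the metric `G'` back to `G` near `y`. -/
structure IsMetricPullback (Φ : TSpace n → TSpace n) (G G' : TSpace n → Matrix (Fin n) (Fin n) ℝ)
    (y : TSpace n) : Prop where
  smooth : ∀ᶠ z in 𝓝 y, ContDiffAt ℝ ∞ Φ z
  surj : ∀ᶠ z in 𝓝 y, Function.Surjective (fderiv ℝ Φ z)
  pull : ∀ᶠ z in 𝓝 y, ∀ u v,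
    metricBilin G z u v = metricBilin G' (Φ z) (fderiv ℝ Φ z u) (fderiv ℝ Φ z v)
  source : ∀ᶠ z in 𝓝 y, IsSmoothMetricAt G z
  target : ∀ᶠ z in 𝓝 (Φ y), IsSmoothMetricAt G' z

/-- Needed because naturality of the curvature differentiates the transformation law of the
connection, which must therefore hold near `y`. -/
theorem IsMetricPullback.eventually (h : IsMetricPullback Φ G G' y) :
    ∀ᶠ z in 𝓝 y, IsMetricPullback Φ G G' z := by
  have hc : Tendsto Φ (𝓝 y) (𝓝 (Φ y)) := h.smooth.self_of_nhds.continuousAt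
  filter_upwards [h.smooth.eventually_nhds, h.surj.eventually_nhds, h.pull.eventually_nhds,
    h.source.eventually_nhds, hc.eventually h.target.eventually_nhds] with z h1 h2 h3 h4 h5
  exact ⟨h1, h2, h3, h4, h5⟩

theorem IsMetricPullback.transform (h : IsMetricPullback Φ G G' y) (u v : TSpace n) :
    fderiv ℝ Φ y (christoffelBilin G y u v) =
      christoffelBilin G' (Φ y) (fderiv ℝ Φ y u) (fderiv ℝ Φ y v)
        + fderiv ℝ (fderiv ℝ Φ) y u v := by
  have hs := h.source.self_of_nhds
  have ht := h.target.self_of_nhds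
  exact IsLeviCivitaAt.transform (h.smooth.self_of_nhds.of_le ENat.LEInfty.out)
    (hs.contDiffAt_metricBilin.differentiableAt (by simp))
    (ht.contDiffAt_metricBilin.differentiableAt (by simp)) h.pull ht.metricBilin_symm
    ht.metricBilin_nondeg h.surj.self_of_nhds (isLeviCivitaAt_christoffelBilin h.source)
    (isLeviCivitaAt_christoffelBilin h.target) u v

theorem IsMetricPullback.curvatureTensor_eq (h : IsMetricPullback Φ G G' y)
    (u v w x : TSpace n) :
    curvatureTensor G y u v w x = curvatureTensor G' (Φ y) (fderiv ℝ Φ y u) (fderiv ℝ Φ y v)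
      (fderiv ℝ Φ y w) (fderiv ℝ Φ y x) := by
  have hs := h.source.self_of_nhds
  have ht := h.target.self_of_nhds
  rw [curvatureTensor, h.pull.self_of_nhds, curvatureTensor,
    curvatureOperator_transform (Γ' := christoffelBilin G')
      (h.smooth.self_of_nhds.of_le ENat.LEInfty.out)
      (hs.contDiffAt_christoffelBilin.differentiableAt (by simp))
      (ht.contDiffAt_christoffelBilin.differentiableAt (by simp))
      (h.eventually.mono fun z hz => hz.transform)]

theorem isLinearMap_curvatureTensor₁ (v w x : TSpace n) :
    IsLinearMap ℝ fun u => curvatureTensor G y u v w x := by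
  constructor
  · intro a b
    simp only [curvatureTensor, curvatureOperator, map_add, map_sub, add_apply]
    ring
  · intro r a
    simp only [curvatureTensor, curvatureOperator, map_add, map_sub, map_smul, smul_apply,
      smul_eq_mul]
    ring

theorem isLinearMap_curvatureTensor₂ (u w x : TSpace n) :
    IsLinearMap ℝ fun v => curvatureTensor G y u v w x := by
  constructor
  · intro a b
    simp only [curvatureTensor, curvatureOperator, map_add, map_sub, add_apply]
    ring
  · intro r a
    simp only [curvatureTensor, curvatureOperator, map_add, map_sub, map_smul, smul_apply,
      smul_eq_mul]
    ring

theorem isLinearMap_curvatureTensor₃ (u v x : TSpace n) :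
    IsLinearMap ℝ fun w => curvatureTensor G y u v w x := by
  constructor
  · intro a b
    simp only [curvatureTensor, map_add, add_apply]
  · intro r a
    simp only [curvatureTensor, map_smul, smul_apply]

theorem isLinearMap_curvatureTensor₄ (u v w : TSpace n) :
    IsLinearMap ℝ fun x => curvatureTensor G y u v w x := by
  constructor
  · intro a b
    simp only [curvatureTensor, curvatureOperator, map_add, map_sub]
    ring
  · intro r a
    simp only [curvatureTensor, curvatureOperator, map_add, map_sub, map_smul, smul_eq_mul]
    ring

theorem IsMetricPullback.pullback_riemann (h : IsMetricPullback Φ G G' y) :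
    pullbackDouble (fderiv ℝ Φ y).toLinearMap (ofComponents₂ (curvatureComponents G' (Φ y))) =
      ofComponents₂ (curvatureComponents G y) := by
  refine pullbackDouble_ofComponents₂ _ fun i j k l => ?_
  have hs := h.source.self_of_nhds
  have ht := h.target.self_of_nhds
  simp only [curvatureComponents_eq hs, curvatureComponents_eq ht,
    ContinuousLinearMap.coe_coe]
  rw [h.curvatureTensor_eq, (isLinearMap_curvatureTensor₁ _ _ _).eq_sum]
  refine Finset.sum_congr rfl fun a _ => ?_
  rw [(isLinearMap_curvatureTensor₂ _ _ _).eq_sum]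
  congr 1
  refine Finset.sum_congr rfl fun b _ => ?_
  rw [(isLinearMap_curvatureTensor₃ _ _ _).eq_sum]
  congr 1
  refine Finset.sum_congr rfl fun c _ => ?_
  rw [(isLinearMap_curvatureTensor₄ _ _ _).eq_sum]

theorem IsMetricPullback.pullback_metric (h : IsMetricPullback Φ G G' y) :
    pullbackDouble (fderiv ℝ Φ y).toLinearMap (ofComponents₁ (G' (Φ y))) =
      ofComponents₁ (G y) := by
  refine pullbackDouble_ofComponents₁ _ fun i j => ?_
  rw [← metricBilin_stdBasis G, h.pull.self_of_nhds, metricBilin_apply]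
  refine Finset.sum_congr rfl fun a _ => ?_
  rw [Finset.mul_sum]
  refine Finset.sum_congr rfl fun b _ => ?_
  simp only [ContinuousLinearMap.coe_coe]
  ring

end Pullback

/-! ## Orthonormal bases -/

section Orthonormal

variable {n : ℕ}

open scoped MatrixOrder in
theorem Matrix.PosDef.exists_transpose_mul_self {A : Matrix (Fin n) (Fin n) ℝ} (hA : A.PosDef) :
    ∃ B : Matrix (Fin n) (Fin n) ℝ, A = B.transpose * B := by
  obtain ⟨B, hB⟩ := CStarAlgebra.nonneg_iff_eq_star_mul_self.mp hA.posSemidef.nonneg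
  refine ⟨B, hB.trans ?_⟩
  rw [Matrix.star_eq_conjTranspose, Matrix.conjTranspose_eq_transpose_of_trivial]

theorem interiorProd_sum_smul (c : Fin n → ℝ) (x : Fin n → TSpace n) :
    interiorProd (∑ a, c a • x a) = ∑ a, c a • interiorProd (x a) := by
  ext1 α
  simp [interiorProd]

/-- Orthonormal bases for a scalar product on the model space. -/
theorem exists_orthonormal_basis {A : Matrix (Fin n) (Fin n) ℝ} (hA : A.PosDef) :
    ∃ b : Module.Basis (Fin n) ℝ (TSpace n), ofComponents₁ A = basisMetric b ∧
      contraction A = basisContraction b ∧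
      ∀ u v, flat b u v = ∑ i, ∑ j, A i j * (u i * v j) := by
  obtain ⟨B, hB⟩ := hA.exists_transpose_mul_self
  have hu : IsUnit B.det := by
    have := hA.det_pos.ne'
    rw [hB, Matrix.det_mul] at this
    exact isUnit_iff_ne_zero.2 (right_ne_zero_of_mul this)
  -- The basis whose coordinate map is `v ↦ B v`: from `A = Bᵀ B` it is orthonormal for `A`, and its
  -- vectors are the columns of `B⁻¹`.
  set b : Module.Basis (Fin n) ℝ (TSpace n) := Module.Basis.ofEquivFun
    ((WithLp.linearEquiv 2 ℝ (Fin n → ℝ)).trans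
      (Matrix.toLin'OfInv (Matrix.nonsing_inv_mul B hu) (Matrix.mul_nonsing_inv B hu))) with hb
  have hrepr : ∀ v i, b.repr v i = ∑ a, B i a * v a := fun v i => by
    rw [hb, Module.Basis.ofEquivFun_repr_apply]
    rfl
  have hbi : ∀ i, b i = ∑ a, B⁻¹ a i • (stdBasis n a : TSpace n) := by
    intro i
    apply b.repr.injective
    ext j
    rw [b.repr_self, hrepr, Finsupp.single_apply]
    have h1 : (B * B⁻¹) j i = if i = j then 1 else 0 := by
      rw [Matrix.mul_nonsing_inv B hu, Matrix.one_apply]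
      simp only [eq_comm]
    rw [← h1, Matrix.mul_apply]
    refine Finset.sum_congr rfl fun a _ => ?_
    congr 1
    simp [Pi.single_apply]
  have hcoord : ∀ i, b.coord i = ∑ a, B i a • (stdBasis n).coord a := by
    intro i
    ext v
    simp only [LinearMap.sum_apply, LinearMap.smul_apply, Module.Basis.coord_apply, hrepr]
    rfl
  have hAij : ∀ i j, A i j = ∑ k, B k i * B k j := by
    intro i j
    rw [hB, Matrix.mul_apply]
    rfl
  have hAinv : ∀ i j, A⁻¹ i j = ∑ k, B⁻¹ i k * B⁻¹ j k := by
    intro i j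
    rw [hB, Matrix.mul_inv_rev, Matrix.mul_apply]
    refine Finset.sum_congr rfl fun k _ => ?_
    rw [← Matrix.transpose_nonsing_inv]
    rfl
  refine ⟨b, ?_, ?_, fun u v => ?_⟩
  · have h1 : ∀ i, leftForm (b.coord i) * rightForm (b.coord i) =
        ∑ a, ∑ c, (B i a * B i c) • (dx a ⊗ₜ[ℝ] dx c : DForms n) := by
      intro i
      simp only [hcoord, leftForm_sum, rightForm_sum, leftForm_smul, rightForm_smul,
        Finset.sum_mul_sum, smul_mul_smul_comm, leftForm_mul_rightForm]
      rfl
    simp only [ofComponents₁, basisMetric, h1, hAij, Finset.sum_smul]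
    rw [Finset.sum_congr rfl fun i _ => Finset.sum_comm, Finset.sum_comm]
  · have h1 : ∀ i, TensorProduct.map (interiorProd (b i)) (interiorProd (b i)) =
        ∑ a, ∑ c, (B⁻¹ a i * B⁻¹ c i) • TensorProduct.map (interiorProd (stdBasis n a))
          (interiorProd (stdBasis n c)) := by
      intro i
      rw [hbi, interiorProd_sum_smul]
      refine TensorProduct.ext' fun α β => ?_
      simp only [TensorProduct.map_tmul, LinearMap.sum_apply, LinearMap.smul_apply,
        TensorProduct.sum_tmul]
      simp only [TensorProduct.tmul_sum, TensorProduct.smul_tmul_smul]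
    simp only [contraction, basisContraction, h1, hAinv, Finset.sum_smul]
    rw [Finset.sum_congr rfl fun i _ => Finset.sum_comm, Finset.sum_comm]
  · simp only [flat_apply, hrepr, Finset.sum_mul_sum]
    simp only [hAij, Finset.sum_mul]
    rw [Finset.sum_comm]
    refine Finset.sum_congr rfl fun a _ => ?_
    rw [Finset.sum_comm]
    refine Finset.sum_congr rfl fun c _ => Finset.sum_congr rfl fun k _ => ?_
    ring

theorem posDef_of_metricBilin {G : TSpace n → Matrix (Fin n) (Fin n) ℝ} {y : TSpace n}
    (hsymm : ∀ i j, G y i j = G y j i) (hpos : ∀ u, u ≠ 0 → 0 < metricBilin G y u u) :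
    (G y).PosDef := by
  refine Matrix.PosDef.of_dotProduct_mulVec_pos ?_ fun x hx => ?_
  · ext i j
    simpa using hsymm j i
  · have := hpos (WithLp.toLp 2 x) (by simpa using hx)
    rw [metricBilin_apply] at this
    simp only [dotProduct, Matrix.mulVec, Finset.mul_sum, star_trivial]
    refine this.trans_eq ?_
    refine Finset.sum_congr rfl fun i _ => Finset.sum_congr rfl fun j _ => ?_
    ring

theorem metricBilin_pos {G : TSpace n → Matrix (Fin n) (Fin n) ℝ} {y : TSpace n}
    (h : (G y).PosDef) {u : TSpace n} (hu : u ≠ 0) : 0 < metricBilin G y u u := by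
  have := h.dotProduct_mulVec_pos (x := fun i => u i) (fun h0 => hu (by
    ext i; exact congrFun h0 i))
  simp only [dotProduct, Matrix.mulVec, Finset.mul_sum, Pi.star_apply, star_trivial] at this
  rw [metricBilin_apply]
  refine this.trans_eq ?_
  refine Finset.sum_congr rfl fun i _ => Finset.sum_congr rfl fun j _ => ?_
  ring

end Orthonormal

/-! ### The second Bianchi identity -/

section Bianchi

variable {E : Type*} [NormedAddCommGroup E] [NormedSpace ℝ E]
  {Γ : E → E →L[ℝ] E →L[ℝ] E} {y : E}

/-- The terms quadratic in `Γ` contribute nothing to the derivative: by the product rule each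
summand retains a factor `Γ y = 0`. -/
theorem hasFDerivAt_curvatureOperator (hΓ : ContDiffAt ℝ 2 Γ y) (h0 : Γ y = 0) (u v w : E) :
    DifferentiableAt ℝ (fun z => curvatureOperator Γ z u v w) y ∧
      ∀ m, fderiv ℝ (fun z => curvatureOperator Γ z u v w) y m =
        fderiv ℝ (fderiv ℝ Γ) y m u v w - fderiv ℝ (fderiv ℝ Γ) y m v u w := by
  have hd : HasFDerivAt Γ (fderiv ℝ Γ y) y := (hΓ.differentiableAt two_ne_zero).hasFDerivAt
  have hD : HasFDerivAt (fderiv ℝ Γ) (fderiv ℝ (fderiv ℝ Γ) y) y :=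
    ((hΓ.fderiv_right (m := 1) le_rfl).differentiableAt one_ne_zero).hasFDerivAt
  have hc : ∀ a : E, HasFDerivAt (fun _ : E => a) (0 : E →L[ℝ] E) y :=
    fun a => hasFDerivAt_const a y
  have h := ((((hD.clm_apply (hc u)).clm_apply (hc v)).clm_apply (hc w)).sub
    (((hD.clm_apply (hc v)).clm_apply (hc u)).clm_apply (hc w))).add
    ((hd.clm_apply (hc u)).clm_apply ((hd.clm_apply (hc v)).clm_apply (hc w))) |>.sub
    ((hd.clm_apply (hc v)).clm_apply ((hd.clm_apply (hc u)).clm_apply (hc w)))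
  refine ⟨h.differentiableAt, fun m => (congrArg (fun L => L m) h.fderiv).trans ?_⟩
  simp [h0]

/-- The second Bianchi identity at a point where the connection form vanishes. -/
theorem curvatureOperator_bianchi (hΓ : ContDiffAt ℝ 2 Γ y) (h0 : Γ y = 0) (m u v w : E) :
    fderiv ℝ (fun z => curvatureOperator Γ z u v w) y m +
      fderiv ℝ (fun z => curvatureOperator Γ z v m w) y u +
      fderiv ℝ (fun z => curvatureOperator Γ z m u w) y v = 0 := by
  have hsymm : ∀ u v w x, fderiv ℝ (fderiv ℝ Γ) y u v w x = fderiv ℝ (fderiv ℝ Γ) y v u w x :=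
    fun u v w x => by rw [hΓ.isSymmSndFDerivAt (by simp)]
  simp only [(hasFDerivAt_curvatureOperator hΓ h0 _ _ _).2]
  rw [hsymm u m, hsymm v m, hsymm v u]
  abel

end Bianchi

/-! ## Schur's lemma in coordinates -/

section Schur

open Filter Topology

variable {n : ℕ}

/-- Products of two one-forms have even degree, hence are central. This makes `R` central among
double forms. -/
theorem ι_mul_ι_mul_comm (ξ η : Module.Dual ℝ (TSpace n)) (α : Forms n) :
    Commute (ExteriorAlgebra.ι ℝ ξ * ExteriorAlgebra.ι ℝ η) α := by
  induction α using ExteriorAlgebra.induction with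
  | algebraMap r => exact (Algebra.commutes r _).symm
  | ι ζ =>
    rw [commute_iff_eq, mul_assoc, ι_mul_ι_comm η ζ, mul_neg, ← mul_assoc, ι_mul_ι_comm ξ ζ,
      neg_mul, neg_neg, mul_assoc]
  | mul a b ha hb => exact ha.mul_right hb
  | add a b ha hb => exact ha.add_right hb

theorem commute_ofComponents₂ (F : Fin n → Fin n → Fin n → Fin n → ℝ) (Ω : DForms n) :
    Commute (ofComponents₂ F) Ω := by
  refine Commute.smul_left (Commute.sum_left _ _ _ fun i _ => Commute.sum_left _ _ _ fun j _ =>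
    Commute.sum_left _ _ _ fun k _ => Commute.sum_left _ _ _ fun l _ =>
      Commute.smul_left ?_ _) _
  induction Ω using TensorProduct.induction_on with
  | zero => exact Commute.zero_right _
  | tmul α β =>
    rw [commute_iff_eq, Algebra.TensorProduct.tmul_mul_tmul, Algebra.TensorProduct.tmul_mul_tmul,
      dx, dx, dx, dx, (ι_mul_ι_mul_comm _ _ α).eq, (ι_mul_ι_mul_comm _ _ β).eq]
  | add a b ha hb => exact ha.add_right hb

/-- The algebraic part of the second Bianchi identity. -/
theorem sum_leftForm_mul_ofComponents₂ {T : Fin n → Fin n → Fin n → Fin n → Fin n → ℝ}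
    (h : ∀ m i j k l, T m i j k l + T i j m k l + T j m i k l = 0) :
    ∑ m, leftForm ((stdBasis n).coord m) * ofComponents₂ (T m) = 0 := by
  set W : Fin n → Fin n → Fin n → DForms n := fun m i j =>
    ∑ k, ∑ l, T m i j k l • ((dx m * (dx i * dx j)) ⊗ₜ[ℝ] (dx k * dx l)) with hW
  have hS : ∑ m, leftForm ((stdBasis n).coord m) * ofComponents₂ (T m) =
      (1 / 4 : ℝ) • ∑ m, ∑ i, ∑ j, W m i j := by
    simp only [ofComponents₂, mul_smul_comm, Finset.mul_sum, Finset.smul_sum, hW, leftForm,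
      Algebra.TensorProduct.tmul_mul_tmul, one_mul]
    rfl
  have hcyc : ∀ V : Fin n → Fin n → Fin n → DForms n,
      ∑ m, ∑ i, ∑ j, V i j m = ∑ m, ∑ i, ∑ j, V m i j := fun V =>
    Finset.sum_comm.trans (Finset.sum_congr rfl fun _ _ => Finset.sum_comm)
  have h1 : ∀ m i j, W m i j + W i j m + W j m i = 0 := by
    intro m i j
    have c1 : (dx i * (dx j * dx m) : Forms n) = dx m * (dx i * dx j) := by
      rw [← mul_assoc]
      exact (ι_mul_ι_mul_comm _ _ _).eq
    have c2 : (dx j * (dx m * dx i) : Forms n) = dx m * (dx i * dx j) := by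
      rw [← mul_assoc (dx m)]
      exact (ι_mul_ι_mul_comm _ _ _).eq.symm
    simp only [hW, c1, c2, ← Finset.sum_add_distrib, ← add_smul, h, zero_smul,
      Finset.sum_const_zero]
  -- Cyclic permutations of three one-forms are even, so the sum equals each of its cyclic
  -- relabellings, and the average of the three vanishes by hypothesis.
  have h2 : (3 : ℝ) • ∑ m, ∑ i, ∑ j, W m i j = ∑ m, ∑ i, ∑ j, (W m i j + W i j m + W j m i) := by
    simp only [Finset.sum_add_distrib]
    rw [hcyc W, ← hcyc fun m i j => W j m i]
    module
  simp only [h1, Finset.sum_const_zero] at h2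
  rw [hS, (smul_eq_zero.1 h2).resolve_left three_ne_zero, smul_zero]

/-- The function `f` with values in the double forms has derivative `f'` at `y`. -/
def HasFormDerivAt (f f' : TSpace n → DForms n) (y : TSpace n) : Prop :=
  ∃ (ι : Type) (_ : Fintype ι) (c : ι → TSpace n → ℝ) (w : ι → DForms n),
    (∀ a, DifferentiableAt ℝ (c a) y) ∧ (∀ z, f z = ∑ a, c a z • w a) ∧
      ∀ v, f' v = ∑ a, fderiv ℝ (c a) y v • w a

variable {f f' g g' : TSpace n → DForms n} {y : TSpace n}

theorem HasFormDerivAt.hasFDerivAt (h : HasFormDerivAt f f' y)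
    (L : Module.Dual ℝ (DForms n)) :
    DifferentiableAt ℝ (fun z => L (f z)) y ∧
      ∀ v, fderiv ℝ (fun z => L (f z)) y v = L (f' v) := by
  obtain ⟨ι, _, c, w, hc, hf, hf'⟩ := h
  have e : (fun z => L (f z)) = fun z => ∑ a, c a z * L (w a) := by
    ext z
    simp [hf]
  have h1 : HasFDerivAt (fun z => ∑ a, c a z * L (w a))
      (∑ a, L (w a) • fderiv ℝ (c a) y) y :=
    HasFDerivAt.fun_sum fun a _ => (hc a).hasFDerivAt.mul_const (L (w a))
  rw [e]
  refine ⟨h1.differentiableAt, fun v => ?_⟩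
  rw [h1.fderiv, hf', map_sum]
  simp [mul_comm]

/-- Linear functionals separate double forms and turn both sides into ordinary derivatives, so the
derivative does not depend on the chosen expansion. -/
theorem HasFormDerivAt.unique (hf : HasFormDerivAt f f' y) (hg : HasFormDerivAt g g' y)
    (h : f =ᶠ[𝓝 y] g) (v : TSpace n) : f' v = g' v := by
  rw [← sub_eq_zero, ← Module.forall_dual_apply_eq_zero_iff ℝ]
  intro L
  have e : (fun z => L (f z)) =ᶠ[𝓝 y] fun z => L (g z) := h.mono fun z hz => by
    simp only [hz]
  rw [map_sub, ← (hf.hasFDerivAt L).2, ← (hg.hasFDerivAt L).2, e.fderiv_eq, sub_self]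

theorem HasFormDerivAt.mul (hf : HasFormDerivAt f f' y) (hg : HasFormDerivAt g g' y) :
    HasFormDerivAt (fun z => f z * g z) (fun v => f' v * g y + f y * g' v) y := by
  obtain ⟨ι, _, c, w, hc, e, e'⟩ := hf
  obtain ⟨ι', _, d, x, hd, r, r'⟩ := hg
  refine ⟨ι × ι', inferInstance, fun a z => c a.1 z * d a.2 z, fun a => w a.1 * x a.2,
    fun a => (hc a.1).mul (hd a.2), fun z => ?_, fun v => ?_⟩
  · simp only
    rw [e, r, Finset.sum_mul_sum, Fintype.sum_prod_type]
    simp only [smul_mul_smul_comm]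
  · simp only
    rw [e', r', e, r, Finset.sum_mul_sum, Finset.sum_mul_sum, ← Finset.sum_add_distrib,
      Fintype.sum_prod_type]
    refine Finset.sum_congr rfl fun a _ => ?_
    rw [← Finset.sum_add_distrib]
    refine Finset.sum_congr rfl fun b _ => ?_
    rw [fderiv_fun_mul (hc a) (hd b), smul_mul_smul_comm, smul_mul_smul_comm, ← add_smul]
    congr 1
    simp only [add_apply, smul_apply, smul_eq_mul]
    ring

theorem HasFormDerivAt.smul {κ : TSpace n → ℝ} (hκ : DifferentiableAt ℝ κ y)
    (hf : HasFormDerivAt f f' y) :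
    HasFormDerivAt (fun z => κ z • f z) (fun v => fderiv ℝ κ y v • f y + κ y • f' v) y := by
  obtain ⟨ι, _, c, w, hc, e, e'⟩ := hf
  refine ⟨ι, inferInstance, fun a z => κ z * c a z, w, fun a => hκ.mul (hc a), fun z => ?_,
    fun v => ?_⟩
  · simp only
    rw [e, Finset.smul_sum]
    simp only [smul_smul]
  · simp only
    rw [e', e, Finset.smul_sum, Finset.smul_sum, ← Finset.sum_add_distrib]
    refine Finset.sum_congr rfl fun a _ => ?_
    rw [fderiv_fun_mul hκ (hc a), smul_smul, smul_smul, ← add_smul]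
    congr 1
    simp only [add_apply, smul_apply, smul_eq_mul]
    ring

theorem hasFormDerivAt_one : HasFormDerivAt (n := n) (fun _ => 1) (fun _ => 0) y :=
  ⟨Unit, inferInstance, fun _ _ => 1, fun _ => 1, fun _ => differentiableAt_const _,
    fun z => by simp, fun v => by simp⟩

theorem HasFormDerivAt.pow (hf : HasFormDerivAt f f' y) (hc : ∀ v, Commute (f y) (f' v)) (k : ℕ) :
    HasFormDerivAt (fun z => f z ^ k) (fun v => ((k : ℝ) • f y ^ (k - 1)) * f' v) y := by
  induction k with
  | zero => simpa using hasFormDerivAt_one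
  | succ k ih =>
    have h1 := hf.mul ih
    simp only [← pow_succ'] at h1
    convert h1 using 2 with v
    rw [← ((hc v).pow_left k).eq, ← mul_assoc, ← add_mul]
    congr 1
    -- For exponent zero the truncated `k - 1` is harmless, as its coefficient is zero.
    rcases k with _ | k
    · simp
    · simp only [Nat.add_sub_cancel, mul_smul_comm, ← pow_succ']
      push_cast
      module

theorem hasFormDerivAt_ofComponents₁ {B : TSpace n → Fin n → Fin n → ℝ}
    (h : ∀ i j, DifferentiableAt ℝ (fun z => B z i j) y) :
    HasFormDerivAt (fun z => ofComponents₁ (B z))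
      (fun v => ofComponents₁ fun i j => fderiv ℝ (fun z => B z i j) y v) y :=
  ⟨Fin n × Fin n, inferInstance, fun a z => B z a.1 a.2, fun a => dx a.1 ⊗ₜ[ℝ] dx a.2,
    fun a => h _ _, fun z => by rw [Fintype.sum_prod_type]; rfl,
    fun v => by rw [Fintype.sum_prod_type]; rfl⟩

theorem hasFormDerivAt_ofComponents₂ {F : TSpace n → Fin n → Fin n → Fin n → Fin n → ℝ}
    (h : ∀ i j k l, DifferentiableAt ℝ (fun z => F z i j k l) y) :
    HasFormDerivAt (fun z => ofComponents₂ (F z))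
      (fun v => ofComponents₂ fun i j k l => fderiv ℝ (fun z => F z i j k l) y v) y :=
  ⟨Fin n × Fin n × Fin n × Fin n, inferInstance, fun a z => F z a.1 a.2.1 a.2.2.1 a.2.2.2,
    fun a => (1 / 4 : ℝ) • ((dx a.1 * dx a.2.1) ⊗ₜ[ℝ] (dx a.2.2.1 * dx a.2.2.2)),
    fun a => h _ _ _ _,
    fun z => by
      simp only [Fintype.sum_prod_type, ofComponents₂, Finset.smul_sum]
      simp only [smul_comm (1 / 4 : ℝ)],
    fun v => by
      simp only [Fintype.sum_prod_type, ofComponents₂, Finset.smul_sum]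
      simp only [smul_comm (1 / 4 : ℝ)]⟩

variable {G : TSpace n → Matrix (Fin n) (Fin n) ℝ}

theorem IsSmoothMetricAt.contDiffAt_curvatureComponents (h : IsSmoothMetricAt G y)
    (i j k l : Fin n) : ContDiffAt ℝ ∞ (fun z => curvatureComponents G z i j k l) y :=
  ContDiffAt.sum fun m _ => (h.smooth k m).mul
    (((contDiffAt_partialDeriv (h.contDiffAt_christoffel _ _ _) _).sub
      (contDiffAt_partialDeriv (h.contDiffAt_christoffel _ _ _) _)).add
      (ContDiffAt.sum fun _ _ =>
        ((h.contDiffAt_christoffel _ _ _).mul (h.contDiffAt_christoffel _ _ _)).sub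
        ((h.contDiffAt_christoffel _ _ _).mul (h.contDiffAt_christoffel _ _ _))))

/-- The derivative of the curvature at a point where the connection form vanishes. -/
theorem fderiv_curvatureComponents (hG : ∀ᶠ z in 𝓝 y, IsSmoothMetricAt G z)
    (hΓ : christoffelBilin G y = 0) (i j k l : Fin n) (v : TSpace n) :
    fderiv ℝ (fun z => curvatureComponents G z i j k l) y v =
      metricBilin G y (stdBasis n k) (fderiv ℝ (fun z => curvatureOperator (christoffelBilin G) z
        (stdBasis n i) (stdBasis n j) (stdBasis n l)) y v) := by
  have hs := hG.self_of_nhds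
  -- Metric compatibility with a vanishing connection; only the curvature operator remains to be
  -- differentiated.
  have hB : fderiv ℝ (metricBilin G) y = 0 := by
    ext u v w
    rw [(isLeviCivitaAt_christoffelBilin hG).compat, hΓ]
    simp
  have hBd : HasFDerivAt (metricBilin G) 0 y :=
    hB ▸ (hs.contDiffAt_metricBilin.differentiableAt (by simp)).hasFDerivAt
  have e : (fun z => curvatureComponents G z i j k l) =ᶠ[𝓝 y] fun z =>
      metricBilin G z (stdBasis n k) (curvatureOperator (christoffelBilin G) z (stdBasis n i)
        (stdBasis n j) (stdBasis n l)) :=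
    hG.mono fun z hz => curvatureComponents_eq hz i j k l
  have hC := (hasFDerivAt_curvatureOperator
    (hs.contDiffAt_christoffelBilin.of_le ENat.LEInfty.out) hΓ (stdBasis n i) (stdBasis n j)
    (stdBasis n l)).1.hasFDerivAt
  have hfin := (hBd.clm_apply (hasFDerivAt_const (stdBasis n k) y)).clm_apply hC
  rw [e.fderiv_eq]
  refine (congrArg (fun L => L v) hfin.fderiv).trans ?_
  simp

/-- Differentiating the hypothesis gives `∂ₘκ g^p = k R^(k-1) ∂ₘR`, since `g` is stationary at `y`.
Multiplying by `dxᵐ` and summing, the Bianchi identity leaves `dκ g^p = 0`, and `p < n` forces `dκ =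
0`. -/
theorem schur_of_christoffel_eq_zero (hG : ∀ᶠ z in 𝓝 y, IsSmoothMetricAt G z)
    (hΓ : christoffelBilin G y = 0) {κ : TSpace n → ℝ} (hκ : DifferentiableAt ℝ κ y)
    {k p : ℕ} (hp : p < n)
    (h : ∀ᶠ z in 𝓝 y, ofComponents₂ (curvatureComponents G z) ^ k =
      κ z • ofComponents₁ (G z) ^ p) : fderiv ℝ κ y = 0 := by
  have hs := hG.self_of_nhds
  obtain ⟨b, hb, -, -⟩ := exists_orthonormal_basis hs.posDef
  have hG0 : ∀ i j v, fderiv ℝ (fun z => G z i j) y v = 0 := by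
    intro i j v
    have h1 := hasFDerivAt_clm_apply₂ (hs.contDiffAt_metricBilin.differentiableAt (by simp))
      (stdBasis n i) (stdBasis n j) v
    simp only [metricBilin_stdBasis] at h1
    rw [h1, (isLeviCivitaAt_christoffelBilin hG).compat, hΓ]
    simp
  have hg : HasFormDerivAt (fun z => ofComponents₁ (G z)) (fun _ => 0) y := by
    have := hasFormDerivAt_ofComponents₁ (y := y) (B := fun z => G z)
      fun i j => (hs.smooth i j).differentiableAt (by simp)
    convert this using 2 with v
    simp [ofComponents₁, hG0]
  have hR := hasFormDerivAt_ofComponents₂ (y := y) (F := fun z => curvatureComponents G z)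
    fun i j k l => (hs.contDiffAt_curvatureComponents i j k l).differentiableAt (by simp)
  have hRk := hR.pow (fun v => commute_ofComponents₂ _ _) k
  have hgp := (hg.pow (fun v => Commute.zero_right _) p).smul hκ
  have key := fun v => hRk.unique hgp h v
  simp only [mul_zero, smul_zero, add_zero] at key
  have hbianchi : ∑ m, leftForm ((stdBasis n).coord m) * ofComponents₂ (fun i j k l =>
      fderiv ℝ (fun z => curvatureComponents G z i j k l) y (stdBasis n m)) = 0 := by
    refine sum_leftForm_mul_ofComponents₂ fun m i j k l => ?_
    simp only [fderiv_curvatureComponents hG hΓ, ← map_add]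
    rw [curvatureOperator_bianchi (hs.contDiffAt_christoffelBilin.of_le ENat.LEInfty.out) hΓ,
      map_zero]
  set ξ : Module.Dual ℝ (TSpace n) := ∑ m, fderiv ℝ κ y (stdBasis n m) • (stdBasis n).coord m
    with hξ
  have hξ0 : leftForm ξ * basisMetric b ^ p = 0 := by
    rw [hξ, leftForm_sum, Finset.sum_mul]
    have e : ∀ m, leftForm (fderiv ℝ κ y (stdBasis n m) • (stdBasis n).coord m) *
        basisMetric b ^ p = ((k : ℝ) • ofComponents₂ (curvatureComponents G y) ^ (k - 1)) *
          (leftForm ((stdBasis n).coord m) * ofComponents₂ (fun i j k l =>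
            fderiv ℝ (fun z => curvatureComponents G z i j k l) y (stdBasis n m))) := by
      intro m
      have hc : Commute ((k : ℝ) • ofComponents₂ (curvatureComponents G y) ^ (k - 1))
          (leftForm ((stdBasis n).coord m)) :=
        ((commute_ofComponents₂ _ _).pow_left _).smul_left _
      rw [← mul_assoc, hc.eq, mul_assoc, key, leftForm_smul, smul_mul_assoc, mul_smul_comm, hb]
    rw [Finset.sum_congr rfl fun m _ => e m, ← Finset.mul_sum, hbianchi, mul_zero]
  have hξ1 := eq_zero_of_leftForm_mul_pow_eq_zero b hp ξ hξ0
  ext u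
  induction u using stdBasis_induction with
  | h0 => simp
  | h i =>
    have := congrArg (fun ζ : Module.Dual ℝ (TSpace n) => ζ (stdBasis n i)) hξ1
    simpa [hξ, LinearMap.sum_apply, Pi.single_apply] using this
  | hadd u v hu hv => rw [map_add, hu, hv]; simp
  | hsmul r u hu => rw [map_smul, hu]; simp

end Schur

/-! ## Coordinates in which the connection form vanishes at a point -/

section QuadraticMap

open Filter Topology

variable {E : Type*} [NormedAddCommGroup E] [NormedSpace ℝ E]

/-- The quadratic change of coordinates centred at `y` with second derivative `-Γ`. -/
def quadraticMap (Γ : E →L[ℝ] E →L[ℝ] E) (y z : E) : E := y + z - (1 / 2 : ℝ) • Γ z z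

variable {Γ : E →L[ℝ] E →L[ℝ] E}

theorem fderiv_quadraticMap (hΓ : ∀ u v, Γ u v = Γ v u) (y : E) :
    fderiv ℝ (quadraticMap Γ y) = fun z => ContinuousLinearMap.id ℝ E - Γ z := by
  ext1 z
  have h := ((hasFDerivAt_id (𝕜 := ℝ) z).const_add y).sub
    ((Γ.hasFDerivAt.clm_apply (hasFDerivAt_id (𝕜 := ℝ) z)).const_smul (1 / 2 : ℝ))
  refine HasFDerivAt.fderiv (HasFDerivAt.congr_fderiv h ?_)
  ext u
  simp [hΓ u z, ← two_smul ℝ, smul_smul]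

theorem fderiv_fderiv_quadraticMap (hΓ : ∀ u v, Γ u v = Γ v u) (y z u v : E) :
    fderiv ℝ (fderiv ℝ (quadraticMap Γ y)) z u v = -Γ u v := by
  rw [fderiv_quadraticMap hΓ, (Γ.hasFDerivAt.const_sub _).fderiv]
  simp

theorem contDiff_quadraticMap (y : E) : ContDiff ℝ ∞ (quadraticMap Γ y) :=
  (contDiff_const.add contDiff_id).sub
    ((Γ.contDiff.clm_apply contDiff_id).const_smul (1 / 2 : ℝ))

/-- The derivative at `0` is the identity, and the invertible operators form an open set. -/
theorem eventually_bijective_fderiv_quadraticMap [CompleteSpace E] (hΓ : ∀ u v, Γ u v = Γ v u)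
    (y : E) : ∀ᶠ z in 𝓝 (0 : E), Function.Bijective (fderiv ℝ (quadraticMap Γ y) z) := by
  have hc : ContinuousAt (fun z => ContinuousLinearMap.id ℝ E - Γ z) 0 :=
    (continuous_const.sub Γ.continuous).continuousAt
  have hu : IsUnit (ContinuousLinearMap.id ℝ E - Γ 0) := by
    rw [map_zero, sub_zero]
    exact isUnit_one
  have := hc.eventually (Units.isOpen.mem_nhds hu)
  rw [fderiv_quadraticMap hΓ]
  filter_upwards [this] with z hz
  obtain ⟨U, hU⟩ := hz
  have e : ContinuousLinearMap.id ℝ E - Γ z = ContinuousLinearEquiv.unitsEquiv ℝ E U := by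
    ext x
    rw [← hU]
    rfl
  simp only [e]
  exact (ContinuousLinearEquiv.unitsEquiv ℝ E U).bijective

end QuadraticMap

/-! ### Schur's lemma at an arbitrary point -/

section LocalSchur

open Filter Topology

variable {n : ℕ} {G : TSpace n → Matrix (Fin n) (Fin n) ℝ} {y : TSpace n}

theorem metricBilin_eq_of_components {B : TSpace n →L[ℝ] TSpace n →L[ℝ] ℝ}
    (h : ∀ i j, G y i j = B (stdBasis n i) (stdBasis n j)) : metricBilin G y = B := by
  ext u v
  induction u using stdBasis_induction with
  | h0 => simp
  | hadd a b ha hb => simp only [map_add, add_apply, ha, hb]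
  | hsmul r a ha => simp only [map_smul, smul_apply, ha]
  | h i =>
  induction v using stdBasis_induction with
  | h0 => simp
  | hadd a b ha hb => simp only [map_add, ha, hb]
  | hsmul r a ha => simp only [map_smul, ha]
  | h j => rw [metricBilin_stdBasis, h]

/-- With `Φ` the quadratic map of the Christoffel symbols at `y`, its derivative at `0` is the
identity and its second derivative is `-Γ`. The transformation law then makes the new connection `Γ
- Γ = 0` at `0`. -/
theorem exists_normal_coordinates (hG : ∀ᶠ z in 𝓝 y, IsSmoothMetricAt G z) :
    ∃ (Φ : TSpace n → TSpace n) (H : TSpace n → Matrix (Fin n) (Fin n) ℝ), Φ 0 = y ∧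
      fderiv ℝ Φ 0 = ContinuousLinearMap.id ℝ _ ∧ IsMetricPullback Φ H G 0 ∧
      christoffelBilin H 0 = 0 := by
  have hΓ := (isLeviCivitaAt_christoffelBilin hG).symm
  set Φ := quadraticMap (christoffelBilin G y) y with hΦ
  have hΦ0 : Φ 0 = y := by simp [hΦ, quadraticMap]
  have hD0 : fderiv ℝ Φ 0 = ContinuousLinearMap.id ℝ _ := by
    rw [hΦ, fderiv_quadraticMap hΓ]
    simp only [map_zero, sub_zero]
  have hsm : ContDiff ℝ ∞ Φ := contDiff_quadraticMap y
  have hc : Tendsto Φ (𝓝 0) (𝓝 y) := by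
    have := hsm.continuous.tendsto 0
    rwa [hΦ0] at this
  have hbij : ∀ᶠ z in 𝓝 0, Function.Bijective (fderiv ℝ Φ z) :=
    eventually_bijective_fderiv_quadraticMap hΓ y
  set H : TSpace n → Matrix (Fin n) (Fin n) ℝ := fun z => Matrix.of fun i j =>
    metricBilin G (Φ z) (fderiv ℝ Φ z (stdBasis n i)) (fderiv ℝ Φ z (stdBasis n j)) with hH
  have hpull : ∀ z u v, metricBilin H z u v =
      metricBilin G (Φ z) (fderiv ℝ Φ z u) (fderiv ℝ Φ z v) := by
    intro z u v
    rw [metricBilin_eq_of_components (B := (metricBilin G (Φ z)).bilinearComp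
      (fderiv ℝ Φ z) (fderiv ℝ Φ z)) fun i j => rfl]
    rfl
  have hsource : ∀ᶠ z in 𝓝 0, IsSmoothMetricAt H z := by
    filter_upwards [hbij, hc.eventually hG] with z hz1 hz2
    refine ⟨fun i j => ?_, posDef_of_metricBilin (fun i j => hz2.metricBilin_symm _ _)
      fun u hu => ?_⟩
    · have h1 : ContDiffAt ℝ ∞ (fun z => metricBilin G (Φ z)) z :=
        ContDiffAt.comp (g := metricBilin G) z hz2.contDiffAt_metricBilin hsm.contDiffAt
      have h2 : ContDiffAt ℝ ∞ (fderiv ℝ Φ) z := hsm.contDiffAt.fderiv_right (m := ∞) (by simp)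
      exact (h1.clm_apply (h2.clm_apply contDiffAt_const)).clm_apply
        (h2.clm_apply contDiffAt_const)
    · rw [hpull]
      refine metricBilin_pos hz2.posDef fun h0 => hu (hz1.1 ?_)
      rw [h0, map_zero]
  have hP : IsMetricPullback Φ H G 0 :=
    ⟨Eventually.of_forall fun z => hsm.contDiffAt, hbij.mono fun z hz => hz.2,
      Eventually.of_forall fun z => hpull z, hsource, hΦ0.symm ▸ hG⟩
  refine ⟨Φ, H, hΦ0, hD0, hP, ?_⟩
  ext1 u
  ext1 v
  have := hP.transform u v
  rw [hD0, hΦ0, hΦ, fderiv_fderiv_quadraticMap hΓ] at this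
  simpa using this

theorem commute_ofComponents₁ (B B' : Fin n → Fin n → ℝ) :
    Commute (ofComponents₁ B) (ofComponents₁ B') := by
  refine Commute.sum_left _ _ _ fun i _ => Commute.sum_left _ _ _ fun j _ =>
    Commute.smul_left (Commute.sum_right _ _ _ fun k _ => Commute.sum_right _ _ _ fun l _ =>
      Commute.smul_right ?_ _) _
  rw [commute_iff_eq, Algebra.TensorProduct.tmul_mul_tmul, Algebra.TensorProduct.tmul_mul_tmul,
    dx, dx, dx, dx, ι_mul_ι_comm, ι_mul_ι_comm ((stdBasis n).coord j), TensorProduct.neg_tmul,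
    TensorProduct.tmul_neg, neg_neg]

/-- If a power of the curvature tensor is a multiple of a power of the metric, then the factor
has vanishing derivative. -/
theorem hasFDerivAt_zero_of_curvature_pow_eq (hG : ∀ᶠ z in 𝓝 y, IsSmoothMetricAt G z)
    {κ : TSpace n → ℝ} {k p : ℕ} (hp : p < n)
    (h : ∀ᶠ z in 𝓝 y, ofComponents₂ (curvatureComponents G z) ^ k =
      κ z • ofComponents₁ (G z) ^ p) : HasFDerivAt κ (0 : TSpace n →L[ℝ] ℝ) y := by
  have hs := hG.self_of_nhds
  -- Differentiability of `κ` is a consequence: a functional `L` nonzero on `g^p` at `y` writes `κ`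
  -- near `y` as the quotient of `L (R^k)` by `L (g^p)`.
  have hκ : DifferentiableAt ℝ κ y := by
    obtain ⟨b, hb, -, -⟩ := exists_orthonormal_basis hs.posDef
    have hne : ofComponents₁ (G y) ^ p ≠ 0 := hb ▸ basisMetric_pow_ne_zero b hp.le
    obtain ⟨L, hL⟩ : ∃ L : Module.Dual ℝ (DForms n), L (ofComponents₁ (G y) ^ p) ≠ 0 := by
      by_contra! h0
      exact hne ((Module.forall_dual_apply_eq_zero_iff ℝ _).1 h0)
    have hg := ((hasFormDerivAt_ofComponents₁ (y := y) (B := fun z => G z)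
      fun i j => (hs.smooth i j).differentiableAt (by simp)).pow
        (fun v => commute_ofComponents₁ _ _) p).hasFDerivAt L
    have hR := ((hasFormDerivAt_ofComponents₂ (y := y) (F := fun z => curvatureComponents G z)
      fun i j k l => (hs.contDiffAt_curvatureComponents i j k l).differentiableAt (by simp)).pow
        (fun v => commute_ofComponents₂ _ _) k).hasFDerivAt L
    refine (hR.1.mul (hg.1.inv hL)).congr_of_eventuallyEq ?_
    filter_upwards [h, hg.1.continuousAt.eventually_ne hL] with z hz hz'
    change κ z = L (ofComponents₂ (curvatureComponents G z) ^ k) *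
      (L (ofComponents₁ (G z) ^ p))⁻¹
    rw [hz, map_smul, smul_eq_mul, mul_inv_cancel_right₀ hz']
  obtain ⟨Φ, H, hΦ0, hD0, hP, hΓ⟩ := exists_normal_coordinates hG
  have hΦd : HasFDerivAt Φ (ContinuousLinearMap.id ℝ _) 0 :=
    hD0 ▸ (hP.smooth.self_of_nhds.differentiableAt (by simp)).hasFDerivAt
  have hκ' : HasFDerivAt κ (fderiv ℝ κ y) (Φ 0) := hΦ0.symm ▸ hκ.hasFDerivAt
  have hcomp := hκ'.comp 0 hΦd
  have hc : Tendsto Φ (𝓝 0) (𝓝 y) := by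
    have := hΦd.continuousAt.tendsto
    rwa [hΦ0] at this
  have h' : ∀ᶠ z in 𝓝 0, ofComponents₂ (curvatureComponents H z) ^ k =
      (κ ∘ Φ) z • ofComponents₁ (H z) ^ p := by
    filter_upwards [hP.eventually, hc.eventually h] with z hz1 hz2
    have := congrArg (pullbackDouble (fderiv ℝ Φ z).toLinearMap) hz2
    rwa [map_smul, map_pow, map_pow, hz1.pullback_riemann, hz1.pullback_metric] at this
  have h0 := schur_of_christoffel_eq_zero hP.source hΓ hcomp.differentiableAt hp h'
  -- As `Φ` has identity derivative at `0`, the derivatives of `κ ∘ Φ` at `0` and of `κ` at `y`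
  -- coincide.
  rw [hcomp.fderiv, ContinuousLinearMap.comp_id] at h0
  exact h0 ▸ hκ.hasFDerivAt

end LocalSchur

/-! ## Metrics on manifolds in charts -/

section Manifold

open Filter Topology Bundle

variable {n : ℕ} {M : Type*} [TopologicalSpace M] [ChartedSpace (TSpace n) M]

theorem eq_of_forall_hasFDerivAt_zero_in_charts [ConnectedSpace M] {μ : M → ℝ}
    (h : ∀ m : M, ∀ y ∈ (extChartAt (𝓡 n) m).target,
      HasFDerivAt (fun z => μ ((extChartAt (𝓡 n) m).symm z)) (0 : TSpace n →L[ℝ] ℝ) y)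
    (m m' : M) : μ m = μ m' := by
  refine IsLocallyConstant.apply_eq_of_isPreconnected (f := μ) (s := Set.univ) ?_ isPreconnected_univ
    (Set.mem_univ _) (Set.mem_univ _)
  refine (IsLocallyConstant.iff_eventually_eq _).2 fun m => ?_
  obtain ⟨r, hr, hball⟩ := Metric.isOpen_iff.1 (isOpen_extChartAt_target (I := 𝓡 n) m) _
    (mem_extChartAt_target m)
  have hconst : ∀ z ∈ Metric.ball (extChartAt (𝓡 n) m m) r,
      μ ((extChartAt (𝓡 n) m).symm z) = μ m := by
    intro z hz
    have := Metric.isOpen_ball.is_const_of_fderiv_eq_zero (𝕜 := ℝ)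
      (f := fun z => μ ((extChartAt (𝓡 n) m).symm z))
      (convex_ball _ _).isPreconnected
      (fun w hw => (h m w (hball hw)).differentiableAt.differentiableWithinAt)
      (fun w hw => (h m w (hball hw)).fderiv) hz (Metric.mem_ball_self hr)
    rwa [extChartAt_to_inv] at this
  filter_upwards [(continuousAt_extChartAt (I := 𝓡 n) m).eventually (Metric.ball_mem_nhds _ hr),
    extChartAt_source_mem_nhds (I := 𝓡 n) m] with p hp hp'
  rw [← hconst _ hp, (extChartAt (𝓡 n) m).left_inv hp']

variable [IsManifold (𝓡 n) ∞ M]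

/-- The scalar product on the tangent space at `m`, as a bilinear form on the model space. -/
def innerAt (g : SmoothMetric n M) (m : M) : TSpace n →L[ℝ] TSpace n →L[ℝ] ℝ := g.inner m

/-- The derivative of the inverse of the preferred chart at `m`, as an endomorphism of the model
space. -/
def chartFrame (m : M) (y : TSpace n) : TSpace n →L[ℝ] TSpace n :=
  mfderiv 𝓘(ℝ, TSpace n) (𝓡 n) (extChartAt (𝓡 n) m).symm y

theorem metricBilin_metricInChart (g : SmoothMetric n M) (m : M) (y u v : TSpace n) :
    metricBilin (metricInChart g m) y u v =
      innerAt g ((extChartAt (𝓡 n) m).symm y) (chartFrame m y u) (chartFrame m y v) := by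
  rw [metricBilin_eq_of_components (B := (innerAt g ((extChartAt (𝓡 n) m).symm y)).bilinearComp
    (chartFrame m y) (chartFrame m y)) fun i j => rfl]
  rfl

theorem chartFrame_injective (m : M) {y : TSpace n} (hy : y ∈ (extChartAt (𝓡 n) m).target) :
    Function.Injective (chartFrame m y) := by
  have h := isInvertible_mfderivWithin_extChartAt_symm (I := 𝓡 n) hy
  rw [(𝓡 n).range_eq_univ, mfderivWithin_univ] at h
  exact h.injective

theorem chartFrame_center (m : M) :
    chartFrame m (extChartAt (𝓡 n) m m) = ContinuousLinearMap.id ℝ (TSpace n) := by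
  have h := mfderivWithin_range_extChartAt_symm (I := 𝓡 n) (x := m)
  rw [(𝓡 n).range_eq_univ, mfderivWithin_univ] at h
  exact h

/-- At its centre the preferred chart induces the identity on the tangent space, which is the
identification used by `gramAt`. -/
theorem gramAt_eq_metricInChart (g : SmoothMetric n M) (m : M) :
    gramAt g m = metricInChart g m (extChartAt (𝓡 n) m m) := by
  ext i j
  change innerAt g m _ _ = innerAt g _ (chartFrame m _ _) (chartFrame m _ _)
  rw [chartFrame_center, extChartAt_to_inv]
  rfl

theorem contDiffAt_metricInChart (g : SmoothMetric n M) (m : M) {y : TSpace n}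
    (hy : y ∈ (extChartAt (𝓡 n) m).target) (i j : Fin n) :
    ContDiffAt ℝ ∞ (fun z => metricInChart g m z i j) y := by
  have hopen := isOpen_extChartAt_target (I := 𝓡 n) m
  have hsymm := contMDiffOn_extChartAt_symm (I := 𝓡 n) (n := ∞) m
  -- A coordinate vector field is the tangent map of the inverse chart applied to a constant field,
  -- hence smooth as a map to the tangent bundle.
  have hframe (i : Fin n) : ContMDiffAt 𝓘(ℝ, TSpace n) (𝓡 n).tangent ∞ (fun z =>
      TotalSpace.mk' (TSpace n) (E := fun p : M => TangentSpace (𝓡 n) p)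
        ((extChartAt (𝓡 n) m).symm z)
        (mfderiv 𝓘(ℝ, TSpace n) (𝓡 n) (extChartAt (𝓡 n) m).symm z (stdBasis n i))) y := by
    have h1 := hsymm.contMDiffOn_tangentMapWithin (m := ∞) (by simp)
      hopen.uniqueMDiffOn
    have h2 : ContMDiffAt 𝓘(ℝ, TSpace n) 𝓘(ℝ, TSpace n).tangent ∞ (fun z =>
        (⟨z, (stdBasis n i : TSpace n)⟩ : TangentBundle 𝓘(ℝ, TSpace n) (TSpace n))) y :=
      contMDiffAt_vectorSpace_iff_contDiffAt.2 contDiffAt_const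
    have h3 := (h1.contMDiffAt (x := ⟨y, (stdBasis n i : TSpace n)⟩)
      ((hopen.preimage (FiberBundle.continuous_proj _ _)).mem_nhds hy)).comp y h2
    refine h3.congr_of_eventuallyEq ?_
    filter_upwards [hopen.mem_nhds hy] with z hz
    simp only [Function.comp, tangentMapWithin]
    rw [mfderivWithin_of_isOpen hopen hz]
  have hinner := (g.contMDiff.contMDiffAt (x := (extChartAt (𝓡 n) m).symm y)).comp y
    (hsymm.contMDiffAt (hopen.mem_nhds hy))
  have h := ContMDiffAt.clm_bundle_apply₂ (E₃ := fun _ : M => ℝ) (F₃ := ℝ) hinner (hframe i) (hframe j)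
  exact (contMDiffAt_totalSpace.1 h).2.contDiffAt

theorem isSmoothMetricAt_metricInChart (g : SmoothMetric n M) (m : M) {y : TSpace n}
    (hy : y ∈ (extChartAt (𝓡 n) m).target) : IsSmoothMetricAt (metricInChart g m) y := by
  refine ⟨contDiffAt_metricInChart g m hy, posDef_of_metricBilin (fun i j => g.symm _ _ _)
    fun u hu => ?_⟩
  rw [metricBilin_metricInChart]
  exact g.pos _ _ fun h => hu (chartFrame_injective m hy (h.trans (map_zero _).symm))

theorem eventually_isSmoothMetricAt (g : SmoothMetric n M) (m : M) {y : TSpace n}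
    (hy : y ∈ (extChartAt (𝓡 n) m).target) :
    ∀ᶠ z in 𝓝 y, IsSmoothMetricAt (metricInChart g m) z := by
  filter_upwards [(isOpen_extChartAt_target (I := 𝓡 n) m).mem_nhds hy] with z hz
  exact isSmoothMetricAt_metricInChart g m hz

/-- Both coordinate metrics represent `g`, so the chain rule for the chart frames shows that the
transition map to the preferred chart of the point over `y` pulls one back to the other. -/
theorem isMetricPullback_transition (g : SmoothMetric n M) (m : M) {y : TSpace n}
    (hy : y ∈ (extChartAt (𝓡 n) m).target) :
    IsMetricPullback (extChartAt (𝓡 n) ((extChartAt (𝓡 n) m).symm y) ∘ (extChartAt (𝓡 n) m).symm)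
      (metricInChart g m) (metricInChart g ((extChartAt (𝓡 n) m).symm y)) y := by
  set m' := (extChartAt (𝓡 n) m).symm y with hm'
  have hopen := isOpen_extChartAt_target (I := 𝓡 n) m
  have hsymm := contMDiffOn_extChartAt_symm (I := 𝓡 n) (n := ∞) m
  have hnear : ∀ᶠ z in 𝓝 y, z ∈ (extChartAt (𝓡 n) m).target ∧
      (extChartAt (𝓡 n) m).symm z ∈ (extChartAt (𝓡 n) m').source :=
    (hopen.eventually_mem hy).and
      ((hsymm.contMDiffAt (hopen.mem_nhds hy)).continuousAt.eventually
        ((isOpen_extChartAt_source (I := 𝓡 n) m').eventually_mem (mem_extChartAt_source m')))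
  have hsm : ∀ᶠ z in 𝓝 y, ContDiffAt ℝ ∞
      (extChartAt (𝓡 n) m' ∘ (extChartAt (𝓡 n) m).symm) z := by
    filter_upwards [hnear] with z hz
    rw [← contMDiffAt_iff_contDiffAt]
    refine (contMDiffAt_extChartAt' ?_).comp z (hsymm.contMDiffAt (hopen.mem_nhds hz.1))
    rw [← extChartAt_source (𝓡 n)]
    exact hz.2
  have hpull : ∀ᶠ z in 𝓝 y, ∀ u v, metricBilin (metricInChart g m) z u v =
      metricBilin (metricInChart g m')
        ((extChartAt (𝓡 n) m' ∘ (extChartAt (𝓡 n) m).symm) z)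
        (fderiv ℝ (extChartAt (𝓡 n) m' ∘ (extChartAt (𝓡 n) m).symm) z u)
        (fderiv ℝ (extChartAt (𝓡 n) m' ∘ (extChartAt (𝓡 n) m).symm) z v) := by
    filter_upwards [hnear.eventually_nhds, hsm] with z hz hz' u v
    have hz0 := hz.self_of_nhds
    set Φ := extChartAt (𝓡 n) m' ∘ (extChartAt (𝓡 n) m).symm with hΦ
    have hmem : Φ z ∈ (extChartAt (𝓡 n) m').target := (extChartAt (𝓡 n) m').map_source hz0.2
    have heq : (extChartAt (𝓡 n) m).symm =ᶠ[𝓝 z] (extChartAt (𝓡 n) m').symm ∘ Φ := by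
      filter_upwards [hz] with w hw
      exact ((extChartAt (𝓡 n) m').left_inv hw.2).symm
    have hframe : chartFrame m z = (chartFrame m' (Φ z)).comp (fderiv ℝ Φ z) := by
      have h1 : mfderiv 𝓘(ℝ, TSpace n) (𝓡 n) ((extChartAt (𝓡 n) m').symm ∘ Φ) z =
          (mfderiv 𝓘(ℝ, TSpace n) (𝓡 n) (extChartAt (𝓡 n) m').symm (Φ z)).comp
            (mfderiv 𝓘(ℝ, TSpace n) 𝓘(ℝ, TSpace n) Φ z) := by
        refine mfderiv_comp z ?_ ?_
        · exact ((contMDiffOn_extChartAt_symm (I := 𝓡 n) (n := ∞) m').contMDiffAt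
            ((isOpen_extChartAt_target (I := 𝓡 n) m').mem_nhds hmem)).mdifferentiableAt (by simp)
        · exact (hz'.differentiableAt (by simp)).mdifferentiableAt
      rw [mfderiv_eq_fderiv] at h1
      exact heq.mfderiv_eq.trans h1
    rw [metricBilin_metricInChart, metricBilin_metricInChart, hframe, heq.eq_of_nhds]
    rfl
  have hΦy : (extChartAt (𝓡 n) m' ∘ (extChartAt (𝓡 n) m).symm) y ∈
      (extChartAt (𝓡 n) m').target := (extChartAt (𝓡 n) m').map_source hnear.self_of_nhds.2
  refine ⟨hsm, ?_, hpull, eventually_isSmoothMetricAt g m hy,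
    eventually_isSmoothMetricAt g m' hΦy⟩
  -- A vector killed by the derivative would have length zero, so the derivative is injective, and
  -- surjective by finite dimension.
  filter_upwards [hpull, eventually_isSmoothMetricAt g m hy] with z hz hz'
  refine LinearMap.injective_iff_surjective
    (f := (fderiv ℝ (extChartAt (𝓡 n) m' ∘ (extChartAt (𝓡 n) m).symm) z).toLinearMap).1 ?_
  refine (injective_iff_map_eq_zero _).2 fun u hu => ?_
  by_contra h0
  have h1 := metricBilin_pos hz'.posDef h0
  rw [hz u u, show fderiv ℝ (extChartAt (𝓡 n) m' ∘ (extChartAt (𝓡 n) m).symm) z u = 0 from hu,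
    map_zero] at h1
  exact h1.false

/-! ### The pointwise identity and Schur's lemma on the manifold -/

theorem exists_thorpe_eq_smul (g : SmoothMetric n M) {k : ℕ} (hk : 1 ≤ k) (hn : 2 * k ≤ n)
    (hE : IsHyperEinstein g k) (hC : IsConformallyFlatOfOrder g k) (m : M) :
    ∃ μ : ℝ, thorpe g k m = μ • metricForm g m ^ (2 * k) := by
  obtain ⟨lam, hlam⟩ := hE
  obtain ⟨θ, hθ, h⟩ := hC m
  have hpos : (gramAt g m).PosDef := gramAt_eq_metricInChart g m ▸
    (isSmoothMetricAt_metricInChart g m (mem_extChartAt_target m)).posDef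
  obtain ⟨b, hb, hc, -⟩ := exists_orthonormal_basis hpos
  have h1 := hlam m
  rw [h, metricForm, contractionAt, hb, hc] at h1
  obtain ⟨μ, hμ⟩ := exists_eq_smul_basisMetric_pow b (by lia) hθ h1
  refine ⟨μ, ?_⟩
  rw [h, metricForm, hb, hμ, show 2 * k - 1 + 1 = 2 * k by lia]

/-- The hypothesis at each point is expressed in that point's own chart; pulling it back by the
transition maps puts all these identities into the single chart at `m`, where the local Schur lemma
applies. -/
theorem hasFDerivAt_zero_of_thorpe_eq_smul (g : SmoothMetric n M) {k p : ℕ} (hp : p < n)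
    {μ : M → ℝ} (h : ∀ m, thorpe g k m = μ m • metricForm g m ^ p) (m : M) {y : TSpace n}
    (hy : y ∈ (extChartAt (𝓡 n) m).target) :
    HasFDerivAt (fun z => μ ((extChartAt (𝓡 n) m).symm z)) (0 : TSpace n →L[ℝ] ℝ) y := by
  refine hasFDerivAt_zero_of_curvature_pow_eq (k := k) (eventually_isSmoothMetricAt g m hy) hp ?_
  filter_upwards [(isOpen_extChartAt_target (I := 𝓡 n) m).mem_nhds hy] with z hz
  have hP := isMetricPullback_transition g m hz
  have h1 := h ((extChartAt (𝓡 n) m).symm z)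
  rw [thorpe, riemannForm, metricForm, gramAt_eq_metricInChart] at h1
  have h2 := congrArg (pullbackDouble (fderiv ℝ (extChartAt (𝓡 n) ((extChartAt (𝓡 n) m).symm z) ∘
    (extChartAt (𝓡 n) m).symm) z).toLinearMap) h1
  rw [map_smul, map_pow, map_pow] at h2
  have h3 := hP.pullback_riemann
  have h4 := hP.pullback_metric
  simp only [Function.comp_apply] at h3 h4
  exact (h3 ▸ h4 ▸ h2 :)

theorem evalDouble_metricForm_pow (g : SmoothMetric n M) (m : M) {p : ℕ} (x : Fin p → TSpace n)
    (hx : ∀ i j, innerAt g m (x i) (x j) = if i = j then 1 else 0) :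
    evalDouble x x (metricForm g m ^ p) = p.factorial := by
  have hpos : (gramAt g m).PosDef := gramAt_eq_metricInChart g m ▸
    (isSmoothMetricAt_metricInChart g m (mem_extChartAt_target m)).posDef
  obtain ⟨b, hb, -, hflat⟩ := exists_orthonormal_basis hpos
  rw [metricForm, hb]
  refine evalDouble_basisMetric_pow b x fun i j => ?_
  rw [hflat, ← hx i j, ← metricBilin_apply (G := fun _ => gramAt g m) (y := 0),
    metricBilin_eq_of_components (B := innerAt g m) fun i j => rfl]

end Manifold

end

theorem mainTheorem8 (n k : ℕ) (hk : 1 ≤ k) (hn : 4 * k ≤ n)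
    (M : Type*) [TopologicalSpace M] [ConnectedSpace M] [ChartedSpace (TSpace n) M]
    [IsManifold (𝓡 n) ∞ M] (g : SmoothMetric n M)
    (hE : IsHyperEinstein g k) (hC : IsConformallyFlatOfOrder g k) :
    HasConstantSectionalCurvatureOfOrder g k := by
  choose μ hμ using exists_thorpe_eq_smul g hk (by lia) hE hC
  have hconst := eq_of_forall_hasFDerivAt_zero_in_charts fun m _ hy =>
    hasFDerivAt_zero_of_thorpe_eq_smul g (by lia) hμ m hy
  obtain ⟨m₀⟩ : Nonempty M := inferInstance
  -- The factorial is the value of `g^(2k)` on an orthonormal family.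
  refine ⟨μ m₀ * (2 * k).factorial, fun m x hx => ?_⟩
  rw [hμ, map_smul, smul_eq_mul, hconst m m₀]
  exact congrArg (μ m₀ * ·) (evalDouble_metricForm_pow g m x hx)
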